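/- Machines are (multi-stack, equivalently multi-tape) Turing machines with binary nondeterministic moves, and $\log n$ stands for $\lfloor\log_2 n\rfloor$, with $\log 0=0$. On an instance $(x,k)$, with $x$ a string over a finite alphabet $\Sigma$ and $k\in\mathbb N$, put $n=|x|$. A nondeterministic machine $M$ is *$k$-restricted* if there are computable functions $f,g:\mathbb N\to\mathbb N$ and a polynomial $p$ such that every computation of $M$ on every $(x,k)$ halts after at most $g(k)\,p(n)$ steps and makes at most $f(k)\log n$ nondeterministic moves. Let $\#\mathrm{acc}_M(x,k)$ and $\#\mathrm{rej}_M(x,k)$ be the numbers of accepting and rejecting computation paths, and let $\Pr[M\text{ accepts }(x,k)]$ be the probability of acceptance when each nondeterministic move is decided by an independent fair coin toss. FPT is the class of parameterized languages decided by a deterministic machine in time $g(k)\,p(n)$ for some computable $g$ and some polynomial $p$. Gap-FPT is the class of functions $h:\Sigma^*\times\mathbb N\to\mathbb Z$ of the form $h(x,k)=\#\mathrm{acc}_M(x,k)-\#\mathrm{rej}_M(x,k)$ with $M$ $k$-restricted. W[P]-PFPT is the class of parameterized languages $L$ for which there is a $k$-restricted machine $M$ with $\Pr[M\text{ accepts }(x,k)]>\frac12$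 for all $(x,k)\in L$ and $\Pr[M\text{ accepts }(x,k)]\le\frac12$ for all $(x,k)\notin L$. **Theorem.** Let $\Sigma$ be a finite alphabet and $L\subseteq\Sigma^*\times\mathbb N$ a parameterized language. The following are equivalent: 1. $L\in$ W[P]-PFPT. 2. There is a $k$-restricted Turing machine $M$ such that for all $(x,k)$: $(x,k)\in L\iff \#\mathrm{acc}_M(x,k)-\#\mathrm{rej}_M(x,k)>0$. 3. There is a function $h\in$ Gap-FPT such that for all $(x,k)$: $(x,k)\in L\iff h(x,k)>0$. 4. There are a language $B\in$ FPT (of instances $(\langle x,y\rangle,k)$ with parameter $k$) and a computable function $f:\mathbb N\to\mathbb N$ such that, with $P(n,k)=f(k)\log n$, for all $(x,k)$ with $n=|x|$: $$(x,k)\in L\iff \bigl|\{y\in\{0,1\}^{P(n,k)} : (\langle x,y\rangle,k)\in B\}\bigr|>\tfrac12\cdot 2^{P(n,k)}.$$ -/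

import Mathlib

open scoped ENNReal

/-- A parameterized language over the alphabet `A`: a set of pairs (input, parameter). -/
abbrev ParamLanguage (A : Type) : Type := Set (List A × ℕ)

/-- The code attached to a label of a nondeterministic machine: either one statement
(a deterministic move), or two statements, one for each value of a bit that is guessed
(nondeterministic reading) or tossed (probabilistic reading). -/
inductive NMove (S : Type) : Type
  | det (s : S) : NMove S
  | coin (s : Bool → S) : NMove S

/-- A nondeterministic Turing machine with input alphabet `A`. This is the finite multi-stack
Turing machine of Mathlib (`Turing.TM2`; a tape is a pair of stacks), except that a label may carry
a binary nondeterministic move. All components are finite. A machine halts by a `halt` statement,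
and it then accepts if its internal state lies in `accept`, and rejects otherwise. -/
structure NTM (A : Type) where
  /-- index type of the stacks -/
  K : Type
  [decEqK : DecidableEq K]
  [finK : Finite K]
  /-- stack alphabets -/
  Γ : K → Type
  [finΓ : ∀ i, Finite (Γ i)]
  /-- labels of the program -/
  Λ : Type
  [finΛ : Finite Λ]
  /-- internal states -/
  σ : Type
  [finσ : Finite σ]
  /-- the input stack -/
  k₀ : K
  /-- the input alphabet, with one further symbol `none`, is part of the alphabet of the input
  stack -/
  emb : Option A ↪ Γ k₀
  /-- the label at which the program starts -/
  main : Λ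
  /-- the initial internal state -/
  start : σ
  /-- the accepting internal states -/
  accept : Set σ
  /-- the program -/
  prog : Λ → NMove (Turing.TM2.Stmt Γ Λ σ)

attribute [instance] NTM.decEqK NTM.finK NTM.finΓ NTM.finΛ NTM.finσ

namespace NTM

variable {A : Type}

/-- Configurations: current label (`none` if halted), internal state, contents of the stacks. -/
abbrev Cfg (M : NTM A) : Type := Turing.TM2.Cfg M.Γ M.Λ M.σ

/-- An instance `(x, k)` is written on the input stack as the string `x`, first letter on top,
followed by `k` in unary, in the additional symbol `none`. -/
def inputString (x : List A) (k : ℕ) : List (Option A) :=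
  x.map some ++ List.replicate k none

/-- The initial configuration on the instance `(x, k)`; all other stacks are empty. -/
def initCfg (M : NTM A) (x : List A) (k : ℕ) : M.Cfg where
  l := some M.main
  var := M.start
  stk := Function.update (fun _ => []) M.k₀ ((inputString x k).map M.emb)

/-- `M.Run c t w c'`: from `c` the machine can reach `c'` in exactly `t` steps, where `w` is the
list of the outcomes of the nondeterministic moves on the way, in order. -/
inductive Run (M : NTM A) : M.Cfg → ℕ → List Bool → M.Cfg → Prop
  | refl (c : M.Cfg) : Run M c 0 [] c
  | det {c c' : M.Cfg} {l : M.Λ} {s : Turing.TM2.Stmt M.Γ M.Λ M.σ} {t : ℕ} {w : List Bool}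
      (hl : c.l = some l) (hs : M.prog l = NMove.det s)
      (h : Run M (Turing.TM2.stepAux s c.var c.stk) t w c') : Run M c (t + 1) w c'
  | coin {c c' : M.Cfg} {l : M.Λ} {s : Bool → Turing.TM2.Stmt M.Γ M.Λ M.σ} {t : ℕ}
      {w : List Bool} (b : Bool)
      (hl : c.l = some l) (hs : M.prog l = NMove.coin s)
      (h : Run M (Turing.TM2.stepAux (s b) c.var c.stk) t w c') : Run M c (t + 1) (b :: w) c'

/-- The accepting computation paths on `(x, k)`, each given by its list of nondeterministic
choices (which determines the path). -/
def accPaths (M : NTM A) (x : List A) (k : ℕ) : Set (List Bool) :=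
  {w | ∃ t c, M.Run (M.initCfg x k) t w c ∧ c.l = none ∧ c.var ∈ M.accept}

/-- The rejecting computation paths on `(x, k)`. -/
def rejPaths (M : NTM A) (x : List A) (k : ℕ) : Set (List Bool) :=
  {w | ∃ t c, M.Run (M.initCfg x k) t w c ∧ c.l = none ∧ c.var ∉ M.accept}

/-- `#acc_M(x, k)` -/
noncomputable def numAcc (M : NTM A) (x : List A) (k : ℕ) : ℕ := (M.accPaths x k).ncard

/-- `#rej_M(x, k)` -/
noncomputable def numRej (M : NTM A) (x : List A) (k : ℕ) : ℕ := (M.rejPaths x k).ncard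

/-- The probability that `M` accepts `(x, k)` when each nondeterministic move is decided by an
independent fair coin: a path with `m` coin tosses has probability `2⁻ᵐ`. -/
noncomputable def probAcc (M : NTM A) (x : List A) (k : ℕ) : ℝ≥0∞ :=
  ∑' w : M.accPaths x k, (2⁻¹ : ℝ≥0∞) ^ (w : List Bool).length

/-- Every computation of `M` on `(x, k)` halts after at most `g(k) * p(|x|)` steps, for some
computable function `g` and some polynomial `p`. (A computation can be prolonged until it halts,
so it is enough to bound the lengths of all partial computations.) -/
def FPTTime (M : NTM A) : Prop :=
  ∃ (g : ℕ → ℕ) (p : Polynomial ℕ), Computable g ∧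
    ∀ (x : List A) (k t : ℕ) (w : List Bool) (c : M.Cfg),
      M.Run (M.initCfg x k) t w c → t ≤ g k * p.eval x.length

/-- `M` is `k`-restricted: it runs in time `g(k) * poly(n)`, and it makes at most
`f(k) * log n` nondeterministic moves, for computable functions `f` and `g`. -/
def KRestricted (M : NTM A) : Prop :=
  M.FPTTime ∧ ∃ f : ℕ → ℕ, Computable f ∧
    ∀ (x : List A) (k t : ℕ) (w : List Bool) (c : M.Cfg),
      M.Run (M.initCfg x k) t w c → w.length ≤ f k * Nat.log 2 x.length

/-- `M` has no nondeterministic moves. -/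
def Deterministic (M : NTM A) : Prop :=
  ∀ l : M.Λ, ∃ s, M.prog l = NMove.det s

end NTM

/-- The class FPT: languages decided by a deterministic machine in time `g(k) * poly(n)`. -/
def InFPT {A : Type} (L : ParamLanguage A) : Prop :=
  ∃ M : NTM A, M.Deterministic ∧ M.FPTTime ∧
    ∀ (x : List A) (k : ℕ), (x, k) ∈ L ↔ (M.accPaths x k).Nonempty

/-- The class W[P]-PFPT. -/
def InWPPFPT {A : Type} (L : ParamLanguage A) : Prop :=
  ∃ M : NTM A, M.KRestricted ∧ ∀ (x : List A) (k : ℕ),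
    ((x, k) ∈ L → M.probAcc x k > 1 / 2) ∧ ((x, k) ∉ L → M.probAcc x k ≤ 1 / 2)

/-- The class Gap-FPT of parameterized functions. -/
def InGapFPT {A : Type} (h : List A → ℕ → ℤ) : Prop :=
  ∃ M : NTM A, M.KRestricted ∧ ∀ (x : List A) (k : ℕ),
    h x k = (M.numAcc x k : ℤ) - (M.numRej x k : ℤ)

/-- The pair `⟨x, y⟩` of an input string and a bit string as one string: `x` followed by `y`,
written in disjoint copies of the two alphabets. -/
def pairString {A : Type} (x : List A) (y : List Bool) : List (A ⊕ Bool) :=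
  x.map Sum.inl ++ y.map Sum.inr

/-! The counting statement about FPT languages (4) is the hub: it is equivalent to (1) and to (2),
while (2) and (3) differ only in naming the function.

From (1) to (4), let $B$ contain $\langle x,y\rangle$ if $M$ accepts when its choices are read from
$y$, and let $P=f(k)\log n$ bound the number of choices. The halting paths form a prefix-free set of
bit strings, and a path with $m$ choices is extended by $2^{P-m}$ strings of length $P$. So the
fraction of good $y$ is exactly the acceptance probability (`exists_fpt_majority_of_probAcc`).

From (2) to (4) every path has to count equally, however few choices it makes. Let $P=(f(k)+1)\log
n$, so that for $\log n>0$ each path leaves $r\ge1$ bits of $y$ unused. The first unused bit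
overrides the decision of the path, unless all later bits are `false`. Then $2^{r-1}+1$ extensions
of an accepting path are good, and $2^{r-1}-1$ of a rejecting one. The halting paths form a complete
prefix code, so the numbers $2^r$ add up to $2^P$ (`sum_two_pow_paths`), and twice the number of
good $y$ is $2^P+2(\#\mathrm{acc}-\#\mathrm{rej})$ (`exists_fpt_majority_of_gap`). If $\log n=0$
there is a single path, and its decision stands.

From (4) to (1) and (2), one machine computes $P=f(k)\log n$, guesses $y$ of length exactly $P$ and
decides $B$ (`exists_guess_machine`). All its paths have the same length, so majority by probability
and majority by number of paths coincide.

The rest is the construction of actual machines. Structured stack programs are compiled to machines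
(`Exec.exists_run`) and can simulate a given machine on prescribed choices (`exists_exec_simulate`).
To compute $f(k)$ within a time that is itself computable in $k$, counter programs are built for
primitive recursive functions (`computable_of_primrec'`) and extended by one unbounded search
(`exists_exec_of_computable`). -/

namespace NTM

/-! ### Computations and their lists of choices -/

variable {A : Type} {M : NTM A}

theorem Run.trans {c c' c'' : M.Cfg} {t t' : ℕ} {w w' : List Bool} (h : M.Run c t w c')
    (h' : M.Run c' t' w' c'') : M.Run c (t + t') (w ++ w') c'' := by
  induction h with
  | refl c => simpa using h'
  | det hl hs _ ih => rw [Nat.add_right_comm]; exact .det hl hs (ih h')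
  | coin b hl hs _ ih => rw [Nat.add_right_comm]; exact .coin b hl hs (ih h')

theorem Run.eq_of_halted {c c' : M.Cfg} {t : ℕ} {w : List Bool} (h : M.Run c t w c')
    (hc : c.l = none) : t = 0 ∧ w = [] ∧ c' = c := by
  cases h with
  | refl => exact ⟨rfl, rfl, rfl⟩
  | det hl => simp [hc] at hl
  | coin _ hl => simp [hc] at hl

/-- A computation whose choices are compatible with those of a halting computation is an initial
segment of it. -/
theorem Run.split_of_compatible {c c' d : M.Cfg} {t T : ℕ} {w W : List Bool}
    (h : M.Run c t w c') (H : M.Run c T W d) (hd : d.l = none)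
    (hW : ∃ u v, W ++ u = w ++ v) :
    ∃ T' u, T = t + T' ∧ W = w ++ u ∧ M.Run c' T' u d := by
  induction h generalizing T W with
  | refl c => exact ⟨T, W, by simp, rfl, H⟩
  | det hl hs _ ih =>
    cases H with
    | refl => simp [hd] at hl
    | det hl' hs' H' =>
      obtain rfl : _ = _ := Option.some.inj (hl.symm.trans hl')
      obtain rfl : _ = _ := NMove.det.inj (hs.symm.trans hs')
      obtain ⟨T', u, rfl, rfl, h'⟩ := ih H' hW
      exact ⟨T', u, by omega, rfl, h'⟩
    | coin b hl' hs' H' =>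
      obtain rfl : _ = _ := Option.some.inj (hl.symm.trans hl')
      simp [hs] at hs'
  | coin b hl hs _ ih =>
    cases H with
    | refl => simp [hd] at hl
    | det hl' hs' H' =>
      obtain rfl : _ = _ := Option.some.inj (hl.symm.trans hl')
      simp [hs] at hs'
    | coin b' hl' hs' H' =>
      obtain rfl : _ = _ := Option.some.inj (hl.symm.trans hl')
      obtain rfl : _ = _ := NMove.coin.inj (hs.symm.trans hs')
      obtain ⟨u, v, huv⟩ := hW
      simp only [List.cons_append, List.cons.injEq] at huv
      obtain ⟨rfl, huv⟩ := huv
      obtain ⟨T', u, rfl, rfl, h'⟩ := ih H' ⟨u, v, huv⟩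
      exact ⟨T', u, by omega, rfl, h'⟩

/-- The hypothesis on `W` and `w` says that one of them is a prefix of the other. Neither halting
run can be prolonged, so the lists agree; this makes the set of halting paths prefix-free. -/
theorem Run.unique {c c' d : M.Cfg} {t T : ℕ} {w W : List Bool}
    (h : M.Run c t w c') (H : M.Run c T W d) (hc' : c'.l = none) (hd : d.l = none)
    (hW : ∃ u v, W ++ u = w ++ v) : W = w ∧ d = c' := by
  obtain ⟨T', u, -, rfl, h'⟩ := h.split_of_compatible H hd hW
  obtain ⟨-, rfl, rfl⟩ := h'.eq_of_halted hc'
  simp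

/-- `Reads y w`: the choices `w` are the first letters of `y`, continued by `false`. -/
def Reads : List Bool → List Bool → Prop
  | _, [] => True
  | y, b :: w => b = y.headD false ∧ Reads y.tail w

theorem reads_nil (y : List Bool) : Reads y [] := by cases y <;> trivial

theorem Reads.prefix {y w : List Bool} (h : Reads y w) (hl : w.length ≤ y.length) :
    w <+: y := by
  induction w generalizing y with
  | nil => exact List.nil_prefix
  | cons b w ih =>
    cases y with
    | nil => simp at hl
    | cons a y =>
      obtain ⟨rfl, h⟩ := h
      simpa using ih h (by simpa using hl)

/-- Follow the choices `y`, and `false` once they are used up; under a bound on the lengths of all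
computations this must reach a halted configuration. The padding makes the statement independent of
the length of `y`. -/
theorem exists_halting_run_of_bounded (B : ℕ) (c : M.Cfg)
    (hB : ∀ t w c', M.Run c t w c' → t ≤ B) (y : List Bool) :
    ∃ t w c', M.Run c t w c' ∧ c'.l = none ∧ Reads y w := by
  induction B generalizing c y with
  | zero =>
    rcases hl : c.l with _ | l
    · exact ⟨0, [], c, .refl c, hl, reads_nil y⟩
    · rcases hs : M.prog l with s | s
      · exact absurd (hB _ _ _ (.det hl hs (.refl _))) (by simp)
      · exact absurd (hB _ _ _ (.coin true hl hs (.refl _))) (by simp)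
  | succ B ih =>
    rcases hl : c.l with _ | l
    · exact ⟨0, [], c, .refl c, hl, reads_nil y⟩
    · rcases hs : M.prog l with s | s
      · obtain ⟨t, w, c', h, hc, hr⟩ := ih (Turing.TM2.stepAux s c.var c.stk)
          (fun t w c' h => Nat.le_of_succ_le_succ (hB _ _ _ (.det hl hs h))) y
        exact ⟨_, _, _, .det hl hs h, hc, hr⟩
      · obtain ⟨t, w, c', h, hc, hr⟩ := ih (Turing.TM2.stepAux (s (y.headD false)) c.var c.stk)
          (fun t w c' h => Nat.le_of_succ_le_succ (hB _ _ _ (.coin _ hl hs h))) y.tail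
        exact ⟨_, _, _, .coin _ hl hs h, hc, rfl, hr⟩

end NTM

/-! ### Structured stack programs and their compilation to machines -/

/-- Atomic operations on a control state and a family of stacks. -/
inductive StackOp {K : Type} (Γ : K → Type) (σ : Type) : Type
  | load (f : σ → σ)
  | push (k : K) (f : σ → Γ k)
  | pop (k : K) (f : σ → Option (Γ k) → σ)
  | peek (k : K) (f : σ → Option (Γ k) → σ)

/-- Structured programs over a family of stacks, with binary nondeterministic moves. -/
inductive StackProg {K : Type} (Γ : K → Type) (σ : Type) : Type
  | op (o : StackOp Γ σ)
  | coin (f : Bool → σ → σ)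
  | seq (p q : StackProg Γ σ)
  | choose (f : σ → StackProg Γ σ)
  | loop (c : σ → Bool) (p : StackProg Γ σ)

section StackProg

variable {K : Type} {Γ : K → Type} {σ : Type}

namespace StackOp

/-- An atomic operation as the first part of a machine statement. -/
def stmt {Λ : Type} : StackOp Γ σ → Turing.TM2.Stmt Γ Λ σ → Turing.TM2.Stmt Γ Λ σ
  | load f, q => .load f q
  | push k f, q => .push k f q
  | pop k f, q => .pop k f q
  | peek k f, q => .peek k f q

end StackOp

namespace StackProg

/-- The program that does nothing. -/
def skip : StackProg Γ σ := .op (.load id)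

/-- The program makes no nondeterministic moves. -/
def NoCoin : StackProg Γ σ → Prop
  | .op _ => True
  | .coin _ => False
  | .seq p q => p.NoCoin ∧ q.NoCoin
  | .choose f => ∀ s, (f s).NoCoin
  | .loop _ p => p.NoCoin

/-- The control points of a program. -/
def Lab : StackProg Γ σ → Type
  | .op _ => Unit
  | .coin _ => Unit
  | .seq p q => p.Lab ⊕ q.Lab
  | .choose f => Unit ⊕ Σ s, (f s).Lab
  | .loop _ p => Unit ⊕ p.Lab

/-- The control point at which a program starts. -/
def entry : (p : StackProg Γ σ) → p.Lab
  | .op _ => ()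
  | .coin _ => ()
  | .seq p _ => .inl p.entry
  | .choose _ => .inl ()
  | .loop _ _ => .inl ()

/-- The machine code of a program that is placed into a larger set of labels by `e` and continues
at the label `exit`. -/
def code {Λ : Type} : (p : StackProg Γ σ) → (p.Lab → Λ) → Λ → p.Lab →
    NMove (Turing.TM2.Stmt Γ Λ σ)
  | .op o, _, exit, _ => .det (o.stmt (.goto fun _ => exit))
  | .coin f, _, exit, _ => .coin fun b => .load (f b) (.goto fun _ => exit)
  | .seq p q, e, _, .inl l => p.code (fun l => e (.inl l)) (e (.inr q.entry)) l
  | .seq _ q, e, exit, .inr l => q.code (fun l => e (.inr l)) exit l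
  | .choose f, e, _, .inl _ => .det (.goto fun s => e (.inr ⟨s, (f s).entry⟩))
  | .choose f, e, exit, .inr ⟨s, l⟩ => (f s).code (fun l => e (.inr ⟨s, l⟩)) exit l
  | .loop c p, e, exit, .inl _ =>
      .det (.goto fun s => if c s then e (.inr p.entry) else exit)
  | .loop _ p, e, _, .inr l => p.code (fun l => e (.inr l)) (e (.inl ())) l

theorem finite_lab [Finite σ] : (p : StackProg Γ σ) → Finite p.Lab
  | .op _ => inferInstanceAs (Finite Unit)
  | .coin _ => inferInstanceAs (Finite Unit)
  | .seq p q =>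
    have := p.finite_lab; have := q.finite_lab; inferInstanceAs (Finite (p.Lab ⊕ q.Lab))
  | .choose f =>
    have := fun s => (f s).finite_lab; inferInstanceAs (Finite (Unit ⊕ Σ s, (f s).Lab))
  | .loop _ p => have := p.finite_lab; inferInstanceAs (Finite (Unit ⊕ p.Lab))

theorem NoCoin.exists_code_eq_det {Λ : Type} {p : StackProg Γ σ} (hp : p.NoCoin)
    (e : p.Lab → Λ) (exit : Λ) (l : p.Lab) : ∃ s, p.code e exit l = .det s := by
  induction p generalizing exit with
  | op o => exact ⟨_, rfl⟩
  | coin f => exact hp.elim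
  | seq p q ihp ihq =>
    rcases l with l | l
    · exact ihp hp.1 _ _ l
    · exact ihq hp.2 _ _ l
  | choose f ih =>
    rcases l with l | ⟨s, l⟩
    · exact ⟨_, rfl⟩
    · exact ih s (hp s) _ _ l
  | loop c p ih =>
    rcases l with l | l
    · exact ⟨_, rfl⟩
    · exact ih hp _ _ l

end StackProg

variable [DecidableEq K]

namespace StackOp

/-- The effect of an atomic operation. -/
def apply : StackOp Γ σ → σ × (∀ k, List (Γ k)) → σ × (∀ k, List (Γ k))
  | load f, m => (f m.1, m.2)
  | push k f, m => (m.1, Function.update m.2 k (f m.1 :: m.2 k))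
  | pop k f, m => (f m.1 (m.2 k).head?, Function.update m.2 k (m.2 k).tail)
  | peek k f, m => (f m.1 (m.2 k).head?, m.2)

theorem stepAux_stmt {Λ : Type} (o : StackOp Γ σ) (q : Turing.TM2.Stmt Γ Λ σ)
    (m : σ × (∀ k, List (Γ k))) :
    Turing.TM2.stepAux (o.stmt q) m.1 m.2 =
      Turing.TM2.stepAux q (o.apply m).1 (o.apply m).2 := by
  cases o <;> rfl

end StackOp

namespace StackProg

/-- `p.Exec m t w m'`: the program `p` leads from `m` to `m'` within `t` steps, with the outcomes
`w` of the nondeterministic moves. -/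
inductive Exec : StackProg Γ σ → σ × (∀ k, List (Γ k)) → ℕ → List Bool →
    σ × (∀ k, List (Γ k)) → Prop
  | op {o m t} (ht : 1 ≤ t) : Exec (.op o) m t [] (o.apply m)
  | coin {f m t} (b : Bool) (ht : 1 ≤ t) : Exec (.coin f) m t [b] (f b m.1, m.2)
  | seq {p q m m' m'' t t' T w w'} (h : Exec p m t w m') (h' : Exec q m' t' w' m'')
      (ht : t + t' ≤ T) : Exec (.seq p q) m T (w ++ w') m''
  | choose {f m m' t T w} (h : Exec (f m.1) m t w m') (ht : t + 1 ≤ T) :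
      Exec (.choose f) m T w m'
  | loop_done {c p m t} (hc : c m.1 = false) (ht : 1 ≤ t) : Exec (.loop c p) m t [] m
  | loop_step {c p m m' m'' t t' T w w'} (hc : c m.1 = true) (h : Exec p m t w m')
      (h' : Exec (.loop c p) m' t' w' m'') (ht : t + t' + 1 ≤ T) :
      Exec (.loop c p) m T (w ++ w') m''

theorem Exec.mono {p : StackProg Γ σ} {m m' : σ × (∀ k, List (Γ k))} {t T : ℕ} {w : List Bool}
    (h : p.Exec m t w m') (hT : t ≤ T) : p.Exec m T w m' := by
  cases h with
  | op h => exact .op (by omega)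
  | coin b h => exact .coin b (by omega)
  | seq h h' ht => exact .seq h h' (by omega)
  | choose h ht => exact .choose h (by omega)
  | loop_done hc ht => exact .loop_done hc (by omega)
  | loop_step hc h h' ht => exact .loop_step hc h h' (by omega)

theorem Exec.op' {o : StackOp Γ σ} {m m' : σ × (∀ k, List (Γ k))} {t : ℕ}
    (hm : o.apply m = m') (ht : 1 ≤ t) : Exec (.op o) m t [] m' := hm ▸ .op ht

theorem Exec.seq_nil {p q : StackProg Γ σ} {m m' m'' : σ × (∀ k, List (Γ k))} {t t' T : ℕ}
    (h : p.Exec m t [] m') (h' : q.Exec m' t' [] m'') (ht : t + t' ≤ T) :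
    Exec (.seq p q) m T [] m'' := .seq (w := []) (w' := []) h h' ht

theorem Exec.loop_step_nil {c : σ → Bool} {p : StackProg Γ σ}
    {m m' m'' : σ × (∀ k, List (Γ k))} {t t' T : ℕ} (hc : c m.1 = true)
    (h : p.Exec m t [] m') (h' : (loop c p).Exec m' t' [] m'') (ht : t + t' + 1 ≤ T) :
    Exec (.loop c p) m T [] m'' := .loop_step (w := []) (w' := []) hc h h' ht

theorem Exec.skip {m : σ × (∀ k, List (Γ k))} {t : ℕ} (ht : 1 ≤ t) :
    (skip : StackProg Γ σ).Exec m t [] m := .op' rfl ht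

variable [Finite K] [∀ k, Finite (Γ k)] [Finite σ] {A : Type}

/-- The machine that runs a program and then halts. -/
def toNTM (p : StackProg Γ σ) (k₀ : K) (emb : Option A ↪ Γ k₀) (start : σ) (accept : Set σ) :
    NTM A :=
  have := p.finite_lab
  { K := K, Γ := Γ, Λ := Option p.Lab, σ := σ, k₀ := k₀, emb := emb, main := some p.entry
    start := start, accept := accept
    prog := fun l => l.elim (.det .halt) (p.code some none) }

/-- Correctness of the compilation. The embedding of labels and the exit label vary in the
induction: the first part of a sequence exits into the entry of the second, and the body of a loop
exits to the loop test. -/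
theorem Exec.exists_run {M : NTM A} {p : StackProg M.Γ M.σ} {m m' : M.σ × (∀ k, List (M.Γ k))}
    {t : ℕ} {w : List Bool} (h : p.Exec m t w m') (e : p.Lab → M.Λ) (exit : M.Λ)
    (he : ∀ l, M.prog (e l) = p.code e exit l) :
    ∃ t' ≤ t, M.Run ⟨some (e p.entry), m.1, m.2⟩ t' w ⟨some exit, m'.1, m'.2⟩ := by
  induction h generalizing exit with
  | @op o m t ht =>
    refine ⟨1, ht, .det rfl (he _) ?_⟩
    rw [StackOp.stepAux_stmt]
    exact .refl _
  | @coin f m t b ht =>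
    exact ⟨1, ht, .coin b rfl (he _) (.refl _)⟩
  | @seq p q m m' m'' t t' T w w' _ _ ht ih ih' =>
    obtain ⟨t₁, h₁, r₁⟩ := ih (fun l => e (.inl l)) (e (.inr q.entry)) fun l => he (.inl l)
    obtain ⟨t₂, h₂, r₂⟩ := ih' (fun l => e (.inr l)) exit fun l => he (.inr l)
    exact ⟨t₁ + t₂, by omega, r₁.trans r₂⟩
  | @choose f m m' t T w _ ht ih =>
    obtain ⟨t₁, h₁, r₁⟩ := ih (fun l => e (.inr ⟨_, l⟩)) exit fun l => he (.inr ⟨_, l⟩)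
    exact ⟨t₁ + 1, by omega, .det rfl (he (.inl ())) r₁⟩
  | @loop_done c p m t hc ht =>
    refine ⟨1, ht, .det rfl (he (.inl ())) ?_⟩
    simp only [Turing.TM2.stepAux, hc]
    exact .refl _
  | @loop_step c p m m' m'' t t' T w w' hc _ _ ht ih ih' =>
    obtain ⟨t₁, h₁, r₁⟩ := ih (fun l => e (.inr l)) (e (.inl ())) fun l => he (.inr l)
    obtain ⟨t₂, h₂, r₂⟩ := ih' e exit he
    refine ⟨t₁ + t₂ + 1, by omega, .det rfl (he (.inl ())) ?_⟩
    simp only [Turing.TM2.stepAux, hc]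
    exact r₁.trans r₂

theorem Exec.exists_toNTM_run {p : StackProg Γ σ} {k₀ : K} {emb : Option A ↪ Γ k₀} {start : σ}
    {accept : Set σ} {x : List A} {k : ℕ} {t : ℕ} {w : List Bool}
    {m' : σ × (∀ k, List (Γ k))}
    (h : p.Exec (start, Function.update (fun _ => []) k₀ ((NTM.inputString x k).map emb))
      t w m') :
    ∃ t' ≤ t + 1, (p.toNTM k₀ emb start accept).Run
      ((p.toNTM k₀ emb start accept).initCfg x k) t' w ⟨none, m'.1, m'.2⟩ := by
  obtain ⟨t', ht', r⟩ := Exec.exists_run (M := p.toNTM k₀ emb start accept) h some none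
    fun _ => rfl
  refine ⟨t' + 1, by omega, ?_⟩
  have := r.trans (.det (s := .halt) rfl rfl (.refl _))
  rwa [List.append_nil] at this

theorem NoCoin.deterministic_toNTM {p : StackProg Γ σ} (hp : p.NoCoin) (k₀ : K)
    (emb : Option A ↪ Γ k₀) (start : σ) (accept : Set σ) :
    (p.toNTM k₀ emb start accept).Deterministic
  | none => ⟨_, rfl⟩
  | some l => hp.exists_code_eq_det _ _ l

end StackProg

end StackProg

/-! ### Counter programs with time bounds -/

/-- Programs for counter machines. -/
inductive CounterProg : Type
  | skip
  | inc (r : ℕ)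
  | dec (r : ℕ)
  | seq (p q : CounterProg)
  | loop (r : ℕ) (p : CounterProg)

namespace CounterProg

open Function (update)

/-- `p.Exec s t s'`: the program `p` leads from `s` to `s'` within `t` steps. -/
inductive Exec : CounterProg → (ℕ → ℕ) → ℕ → (ℕ → ℕ) → Prop
  | skip {s t} (ht : 1 ≤ t) : Exec .skip s t s
  | inc {r s t} (ht : 1 ≤ t) : Exec (.inc r) s t (update s r (s r + 1))
  | dec {r s t} (ht : 1 ≤ t) : Exec (.dec r) s t (update s r (s r - 1))
  | seq {p q s s' s'' t t' T} (h : Exec p s t s') (h' : Exec q s' t' s'') (ht : t + t' ≤ T) :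
      Exec (.seq p q) s T s''
  | loop_done {r p s t} (hr : s r = 0) (ht : 1 ≤ t) : Exec (.loop r p) s t s
  | loop_step {r p s s' s'' t t' T} (hr : s r ≠ 0) (h : Exec p s t s')
      (h' : Exec (.loop r p) s' t' s'') (ht : t + t' + 1 ≤ T) : Exec (.loop r p) s T s''

theorem Exec.mono {p : CounterProg} {s s' : ℕ → ℕ} {t T : ℕ} (h : p.Exec s t s') (hT : t ≤ T) :
    p.Exec s T s' := by
  cases h with
  | skip h => exact .skip (by omega)
  | inc h => exact .inc (by omega)
  | dec h => exact .dec (by omega)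
  | seq h h' ht => exact .seq h h' (by omega)
  | loop_done hr ht => exact .loop_done hr (by omega)
  | loop_step hr h h' ht => exact .loop_step hr h h' (by omega)

theorem Exec.congr {p : CounterProg} {s s' s'' : ℕ → ℕ} {t T : ℕ} (h : p.Exec s t s')
    (hs : ∀ r, s' r = s'' r) (hT : t ≤ T) : p.Exec s T s'' := funext hs ▸ h.mono hT

theorem Exec.inc' {r : ℕ} {s s' : ℕ → ℕ} {t : ℕ} (hs : ∀ i, update s r (s r + 1) i = s' i)
    (ht : 1 ≤ t) : (CounterProg.inc r).Exec s t s' := (Exec.inc ht).congr hs le_rfl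

theorem Exec.dec' {r : ℕ} {s s' : ℕ → ℕ} {t : ℕ} (hs : ∀ i, update s r (s r - 1) i = s' i)
    (ht : 1 ≤ t) : (CounterProg.dec r).Exec s t s' := (Exec.dec ht).congr hs le_rfl

/-- A bound on the registers that occur in a program. -/
def width : CounterProg → ℕ
  | skip => 0
  | inc r => r + 1
  | dec r => r + 1
  | seq p q => max p.width q.width
  | loop r p => max (r + 1) p.width

/-- Empty the register `a`. -/
def clear (a : ℕ) : CounterProg := loop a (dec a)

theorem exec_clear (a : ℕ) (s : ℕ → ℕ) : (clear a).Exec s (2 * s a + 1) (update s a 0) := by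
  generalize hn : s a = n
  induction n generalizing s with
  | zero => exact (Exec.loop_done hn le_rfl).congr (by simp [← hn]) le_rfl
  | succ n ih =>
    refine Exec.loop_step (by omega) (.dec le_rfl) (ih _ (by simp [hn])) le_rfl |>.congr ?_ (by omega)
    simp

/-- Add the register `a` to `b` and `c`, emptying `a`. -/
def move₂ (a b c : ℕ) : CounterProg := loop a (seq (dec a) (seq (inc b) (inc c)))

theorem exec_move₂ {a b c : ℕ} (hab : a ≠ b) (hac : a ≠ c) (hbc : b ≠ c) (s : ℕ → ℕ) :
    (move₂ a b c).Exec s (4 * s a + 1)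
      (update (update (update s b (s b + s a)) c (s c + s a)) a 0) := by
  generalize hn : s a = n
  induction n generalizing s with
  | zero => exact (Exec.loop_done hn le_rfl).congr (by intro r; simp only [Function.update_apply]; grind) le_rfl
  | succ n ih =>
    refine Exec.loop_step (by omega) (.seq (.dec le_rfl) (.seq (.inc le_rfl) (.inc le_rfl) le_rfl)
      le_rfl) (ih _ (by simp [hn, hab, hac])) le_rfl |>.congr ?_ (by omega)
    intro r
    simp only [Function.update_apply]
    grind

/-- Add the register `a` to `b`, emptying `a`. -/
def move (a b : ℕ) : CounterProg := loop a (seq (dec a) (inc b))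

theorem exec_move {a b : ℕ} (hab : a ≠ b) (s : ℕ → ℕ) :
    (move a b).Exec s (3 * s a + 1) (update (update s b (s b + s a)) a 0) := by
  generalize hn : s a = n
  induction n generalizing s with
  | zero => exact (Exec.loop_done hn le_rfl).congr (by intro r; simp only [Function.update_apply]; grind) le_rfl
  | succ n ih =>
    refine Exec.loop_step (by omega) (.seq (.dec le_rfl) (.inc le_rfl) le_rfl)
      (ih _ (by simp [hn, hab])) le_rfl |>.congr ?_ (by omega)
    intro r
    simp only [Function.update_apply]
    grind

/-- Add the register `a` to `b`, with the help of an empty register `c`. -/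
def copy (a b c : ℕ) : CounterProg := seq (move₂ a b c) (move c a)

theorem exec_copy {a b c : ℕ} (hab : a ≠ b) (hac : a ≠ c) (hbc : b ≠ c) {s : ℕ → ℕ}
    (hc : s c = 0) : (copy a b c).Exec s (7 * s a + 2) (update s b (s b + s a)) := by
  refine Exec.seq (exec_move₂ hab hac hbc s) (exec_move hac.symm _) (T := 7 * s a + 2) ?_
    |>.congr ?_ le_rfl
  · simp [hac.symm, hc]; omega
  · intro r
    simp only [Function.update_apply]
    grind

/-! ### Primitive recursive functions on counters -/

/-- `p.Computes ins out base f T`: on states in which the output register and the registers from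
`base` on are empty, the program `p` computes `f` of the input registers within time `T`. -/
def Computes (p : CounterProg) {n : ℕ} (ins : Fin n → ℕ) (out base : ℕ)
    (f T : List.Vector ℕ n → ℕ) : Prop :=
  ∀ s : ℕ → ℕ, (∀ r, base ≤ r → s r = 0) → s out = 0 →
    p.Exec s (T (.ofFn fun i => s (ins i))) (update s out (f (.ofFn fun i => s (ins i))))

/-- The function `f` is computed by counter programs in a primitive recursive time that does not
depend on the position of the registers. -/
def Computable {n : ℕ} (f : List.Vector ℕ n → ℕ) : Prop :=
  ∃ T : List.Vector ℕ n → ℕ, Primrec T ∧ ∀ (ins : Fin n → ℕ) (out base : ℕ),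
    (∀ i, ins i < base) → out < base → (∀ i, ins i ≠ out) →
      ∃ p : CounterProg, p.Computes ins out base f T

theorem primrec_fin_sum {α : Type} [Primcodable α] {n : ℕ} {f : Fin n → α → ℕ}
    (hf : ∀ i, Primrec (f i)) : Primrec fun a => ∑ i, f i a := by
  induction n with
  | zero => simpa using Primrec.const 0
  | succ n ih =>
    simp only [Fin.sum_univ_castSucc]
    exact Primrec.nat_add.comp (ih fun i => hf _) (hf _)

theorem exists_exec_clear_range (base j : ℕ) : ∃ p : CounterProg, ∀ s : ℕ → ℕ,
    p.Exec s (∑ i ∈ Finset.range j, (2 * s (base + i) + 1) + 1)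
      (fun r => if base ≤ r ∧ r < base + j then 0 else s r) := by
  induction j with
  | zero =>
    exact ⟨.skip, fun s => (Exec.skip le_rfl).congr (fun r => (if_neg (by omega)).symm) (by simp)⟩
  | succ j ih =>
    obtain ⟨p, hp⟩ := ih
    refine ⟨.seq p (clear (base + j)), fun s => ?_⟩
    refine (Exec.seq (hp s) (exec_clear _ _) le_rfl).congr (fun r => ?_) ?_
    · simp only [Function.update_apply]
      grind
    · simp [Finset.sum_range_succ]
      omega

/-- The arguments of a composition are computed into a block of consecutive registers. The inputs
lie below the block and the scratch space above it, so the values already found disturb neither. -/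
theorem exists_exec_range (base n : ℕ) {m : ℕ} (ins : Fin m → ℕ) (hins : ∀ i, ins i < base)
    (G T : ℕ → List.Vector ℕ m → ℕ) (hG : ∀ i < n, ∃ p : CounterProg,
      p.Computes ins (base + i) (base + n) (G i) (T i)) (j : ℕ) (hj : j ≤ n) :
    ∃ p : CounterProg, ∀ s : ℕ → ℕ, (∀ r, base ≤ r → s r = 0) →
      p.Exec s (∑ i ∈ Finset.range j, T i (.ofFn fun i => s (ins i)) + 1)
        (fun r => if base ≤ r ∧ r < base + j then G (r - base) (.ofFn fun i => s (ins i))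
          else s r) := by
  induction j with
  | zero =>
    exact ⟨.skip, fun s _ => (Exec.skip le_rfl).congr (fun r => (if_neg (by omega)).symm)
      (by simp)⟩
  | succ j ih =>
    obtain ⟨p, hp⟩ := ih (by omega)
    obtain ⟨q, hq⟩ := hG j (by omega)
    refine ⟨.seq p q, fun s hs => ?_⟩
    have key : ∀ i : Fin m, (if base ≤ ins i ∧ ins i < base + j then
        G (ins i - base) (.ofFn fun i => s (ins i)) else s (ins i)) = s (ins i) :=
      fun i => if_neg (by have := hins i; omega)
    have h := hq (fun r => if base ≤ r ∧ r < base + j then G (r - base) (.ofFn fun i => s (ins i))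
      else s r) (fun r hr => by rw [if_neg (by omega), hs r (by omega)])
      (by rw [if_neg (by omega), hs _ (by omega)])
    simp only [key] at h
    refine (Exec.seq (hp s hs) h le_rfl).congr (fun r => ?_) ?_
    · simp only [Function.update_apply]
      grind
    · rw [Finset.sum_range_succ]
      omega

/-- The intermediate values have to be erased at the end, since a program must leave all registers
from `base` on empty. Erasing costs time linear in these values, which is why primitive
recursiveness of each `g i` enters the time bound. -/
theorem computable_comp {m n : ℕ} {f : List.Vector ℕ n → ℕ} {g : Fin n → List.Vector ℕ m → ℕ}
    (hg' : ∀ i, Primrec (g i)) (hf : Computable f) (hg : ∀ i, Computable (g i)) :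
    Computable fun a => f (.ofFn fun i => g i a) := by
  obtain ⟨Tf, hTf, hf⟩ := hf
  choose Tg hTg hg using hg
  refine ⟨fun v => (∑ i, Tg i v + 1) + (Tf (.ofFn fun i => g i v) +
    (∑ i, (2 * g i v + 1) + 1)), ?_, ?_⟩
  · refine Primrec.nat_add.comp (Primrec.succ.comp (primrec_fin_sum hTg)) (Primrec.nat_add.comp
      (hTf.comp (.vector_ofFn hg')) (Primrec.succ.comp (primrec_fin_sum fun i =>
      Primrec.succ.comp (Primrec.nat_mul.comp (.const 2) (hg' i)))))
  intro ins out base hins hout hne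
  have hg₁ := fun i : Fin n => hg i ins (base + i) (base + n) (fun j => by have := hins j; omega)
    (by omega) (fun j => by have := hins j; omega)
  obtain ⟨pf, hpf⟩ := hf (fun i => base + i) out (base + n) (by simp) (by omega)
    (fun i => by omega)
  obtain ⟨p₁, hp₁⟩ := exists_exec_range base n ins hins
    (fun i v => if h : i < n then g ⟨i, h⟩ v else 0) (fun i v => if h : i < n then Tg ⟨i, h⟩ v else 0)
    (fun i hi => by simpa [hi] using hg₁ ⟨i, hi⟩) n le_rfl
  obtain ⟨p₂, hp₂⟩ := exists_exec_clear_range base n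
  refine ⟨.seq p₁ (.seq pf p₂), fun s hs hs' => ?_⟩
  set v := List.Vector.ofFn fun i => s (ins i) with hv
  have key : ∀ i : Fin n, (if base ≤ base + i.1 ∧ base + i.1 < base + n then
      if h : base + i.1 - base < n then g ⟨base + i.1 - base, h⟩ v else 0 else s (base + i.1)) =
        g i v := fun i => by
    rw [if_pos (by omega), dif_pos (by omega)]
    congr 1
    simp
  have h₁ := hp₁ s hs
  rw [← hv] at h₁
  have h₂ := hpf (fun r => if base ≤ r ∧ r < base + n then
      if h : r - base < n then g ⟨r - base, h⟩ v else 0 else s r)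
    (fun r hr => by rw [if_neg (by omega), hs r (by omega)]) (by rw [if_neg (by omega), hs'])
  simp only [key] at h₂
  refine (Exec.seq h₁ (.seq h₂ (hp₂ _) le_rfl) le_rfl).congr (fun r => ?_) ?_
  · simp only [Function.update_apply]
    grind
  · have : ∀ i : Fin n, base + i.1 ≠ out := fun i => by omega
    simp only [Finset.sum_range, Function.update_apply, this, if_false, key, Fin.is_lt, dif_pos,
      Fin.eta]
    rfl

/-- The recursion is a loop whose round index is in register `base`, the number of rounds left in
`base + 1` and the current value in `out`. The total time is a sum over the rounds, again defined by
primitive recursion. -/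
theorem computable_prec {n : ℕ} {f : List.Vector ℕ n → ℕ} {g : List.Vector ℕ (n + 2) → ℕ}
    (hf' : Primrec f) (hg' : Primrec g) (hf : Computable f) (hg : Computable g) :
    Computable fun v : List.Vector ℕ (n + 1) =>
      v.head.rec (f v.tail) fun y IH => g (y ::ᵥ IH ::ᵥ v.tail) := by
  obtain ⟨Tf, hTf, hf⟩ := hf
  obtain ⟨Tg, hTg, hg⟩ := hg
  -- the value and the accumulated time of the loop after `y` rounds
  let R : List.Vector ℕ (n + 1) → ℕ → ℕ := fun v y =>
    y.rec (f v.tail) fun y IH => g (y ::ᵥ IH ::ᵥ v.tail)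
  let S : List.Vector ℕ (n + 1) → ℕ → ℕ := fun v y =>
    y.rec 0 fun y IH => IH + (Tg (y ::ᵥ R v y ::ᵥ v.tail) + (2 * R v y + 3 * R v (y + 1) + 5))
  have hR : Primrec₂ R := .nat_rec (f := fun v : List.Vector ℕ (n + 1) => f v.tail)
    (g := fun (v : List.Vector ℕ (n + 1)) p => g (p.1 ::ᵥ p.2 ::ᵥ v.tail)) (hf'.comp .vector_tail)
    (hg'.comp (Primrec.vector_cons.comp (Primrec.fst.comp .snd) (Primrec.vector_cons.comp
      (Primrec.snd.comp .snd) (Primrec.vector_tail.comp .fst))))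
  have hS : Primrec₂ S := .nat_rec (f := fun _ => 0)
    (g := fun v p => p.2 + (Tg (p.1 ::ᵥ R v p.1 ::ᵥ v.tail) +
      (2 * R v p.1 + 3 * R v (p.1 + 1) + 5))) (.const 0) <| by
    have h₁ : Primrec fun a : List.Vector ℕ (n + 1) × ℕ × ℕ => R a.1 a.2.1 :=
      hR.comp .fst (Primrec.fst.comp .snd)
    have h₂ : Primrec fun a : List.Vector ℕ (n + 1) × ℕ × ℕ => R a.1 (a.2.1 + 1) :=
      hR.comp .fst (Primrec.succ.comp (Primrec.fst.comp .snd))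
    have h₃ : Primrec fun a : List.Vector ℕ (n + 1) × ℕ × ℕ =>
        Tg (a.2.1 ::ᵥ R a.1 a.2.1 ::ᵥ a.1.tail) :=
      hTg.comp (Primrec.vector_cons.comp (Primrec.fst.comp .snd) (Primrec.vector_cons.comp
        h₁ (Primrec.vector_tail.comp .fst)))
    exact Primrec.nat_add.comp (Primrec.snd.comp .snd) (Primrec.nat_add.comp h₃
      (Primrec.nat_add.comp (Primrec.nat_add.comp (Primrec.nat_mul.comp (.const 2) h₁)
        (Primrec.nat_mul.comp (.const 3) h₂)) (.const 5)))
  refine ⟨fun v => Tf v.tail + (7 * v.head + 2 + (S v v.head + 1 + (2 * v.head + 1))), ?_, ?_⟩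
  · have h₀ : Primrec fun v : List.Vector ℕ (n + 1) => v.head := .vector_head
    exact Primrec.nat_add.comp (hTf.comp .vector_tail) (Primrec.nat_add.comp
      (Primrec.nat_add.comp (Primrec.nat_mul.comp (.const 7) h₀) (.const 2))
      (Primrec.nat_add.comp (Primrec.succ.comp (hS.comp .id h₀))
        (Primrec.succ.comp (Primrec.nat_mul.comp (.const 2) h₀))))
  intro ins out base hins hout hne
  obtain ⟨pf, hpf⟩ := hf (fun i => ins i.succ) out base (fun i => hins _) hout (fun i => hne _)
  -- One of the inputs of `g` is the previous value in `out`, and an output register must differ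
  -- from all inputs; so the new value goes to `base + 2` and is moved to `out` afterwards.
  obtain ⟨pg, hpg⟩ := hg (Fin.cons base (Fin.cons out fun i => ins i.succ)) (base + 2) (base + 3)
    (by
      refine Fin.cases (by simp) (Fin.cases (by simp; omega) fun i => ?_)
      have := hins i.succ
      simp only [Fin.cons_succ]
      omega)
    (by omega)
    (by
      refine Fin.cases (by simp) (Fin.cases (by simp; omega) fun i => ?_)
      have := hins i.succ
      simp only [Fin.cons_succ]
      omega)
  let body : CounterProg := .seq (.dec (base + 1)) (.seq pg (.seq (clear out)
    (.seq (move (base + 2) out) (.inc base))))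
  refine ⟨.seq pf (.seq (copy (ins 0) (base + 1) (base + 2))
    (.seq (.loop (base + 1) body) (clear base))), fun s hs hs' => ?_⟩
  set v := List.Vector.ofFn fun i => s (ins i) with hv
  have htail : @List.Vector.ofFn ℕ n (fun i => s (ins i.succ)) = v.tail := by
    rw [hv, List.Vector.ofFn, List.Vector.tail_cons]
  have hhead : v.head = s (ins 0) := by
    rw [hv, List.Vector.ofFn, List.Vector.head_cons]
  let st : ℕ → ℕ → ℕ → ℕ := fun y c => update (update (update s out (R v y)) base y) (base + 1) c
  -- The time still needed is the difference of two accumulated times plus one for the final loop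
  -- test, stated without subtraction.
  have hloop : ∀ c y, ∃ t, t + S v y = S v (y + c) + 1 ∧
      (CounterProg.loop (base + 1) body).Exec (st y c) t (st (y + c) 0) := by
    intro c
    induction c with
    | zero => exact fun y => ⟨1, by simp; omega, .loop_done (by simp [st]) le_rfl⟩
    | succ c ih =>
      intro y
      obtain ⟨t, ht, h⟩ := ih (y + 1)
      refine ⟨t + (Tg (y ::ᵥ R v y ::ᵥ v.tail) + (2 * R v y + 3 * R v (y + 1) + 5)), ?_, ?_⟩
      · have hS' : S v (y + 1) = S v y +
            (Tg (y ::ᵥ R v y ::ᵥ v.tail) + (2 * R v y + 3 * R v (y + 1) + 5)) := rfl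
        rw [show y + (c + 1) = y + 1 + c by omega]
        omega
      · have hst : ∀ i, st y c (ins i) = s (ins i) := fun i => by
          have := hins i
          have := hne i
          simp only [st, Function.update_apply]
          grind
        have hin : List.Vector.ofFn (fun i => st y c ((Fin.cons base (Fin.cons out
            fun i => ins i.succ) : Fin (n + 2) → ℕ) i)) = y ::ᵥ R v y ::ᵥ v.tail := by
          rw [← htail, List.Vector.ofFn, List.Vector.ofFn]
          simp only [Fin.cons_zero, Fin.cons_succ, hst]
          congr 1
          · simp [st]
          · congr 1
            simp only [st, Function.update_apply]
            grind
        have hg₁ := hpg (st y c) (fun r hr => by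
          simp only [st, Function.update_apply]
          grind) (by
          simp only [st, Function.update_apply]
          grind)
        rw [hin] at hg₁
        have hv₁ : R v (y + 1) = g (y ::ᵥ R v y ::ᵥ v.tail) := rfl
        rw [← hv₁] at hg₁
        have hb : body.Exec (st y (c + 1))
            (Tg (y ::ᵥ R v y ::ᵥ v.tail) + (2 * R v y + 3 * R v (y + 1) + 4)) (st (y + 1) c) := by
          refine Exec.seq (Exec.dec' (s' := st y c) ?_ le_rfl) (.seq hg₁ (.seq (exec_clear _ _)
            (.seq (exec_move (by omega) _) (.inc le_rfl) le_rfl) le_rfl) le_rfl) le_rfl |>.congr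
            ?_ ?_
          · intro r
            simp only [st, Function.update_apply]
            grind
          · intro r
            simp only [st, Function.update_apply]
            grind
          · have h₁ : out ≠ base + 2 := by omega
            have h₂ : out ≠ base + 1 := by omega
            have h₃ : out ≠ base := by omega
            simp [st, h₁, h₁.symm, h₂, h₃]
            omega
        rw [show y + (c + 1) = y + 1 + c by omega]
        exact .loop_step (by simp [st]) hb h (by omega)
  obtain ⟨t, ht, hl⟩ := hloop v.head 0
  have hS0 : S v 0 = 0 := rfl
  rw [Nat.zero_add, hS0, Nat.add_zero] at ht
  have hf₁ : pf.Exec s (Tf v.tail) (update s out (f v.tail)) := htail ▸ hpf s hs hs'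
  have h0 := hins 0
  have h0' := hne 0
  refine Exec.seq hf₁ (.seq (s' := st 0 v.head) ((exec_copy (by omega) (by omega) (by omega) ?_).congr
    ?_ le_rfl) (.seq (hl.mono ht.le) (exec_clear _ _) le_rfl) le_rfl) le_rfl |>.congr ?_ ?_
  · simp only [Function.update_apply]
    grind
  · intro r
    have hR0 : R v 0 = f v.tail := rfl
    simp only [st, Function.update_apply]
    grind
  · intro r
    have hRh : R v v.head = v.head.rec (f v.tail) fun y IH => g (y ::ᵥ IH ::ᵥ v.tail) := rfl
    simp only [st, Function.update_apply, ← hRh]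
    grind
  · simp [st, h0', ← hhead]

theorem computable_of_primrec' {n : ℕ} {f : List.Vector ℕ n → ℕ} (hf : Nat.Primrec' f) :
    Computable f := by
  induction hf with
  | zero =>
    exact ⟨fun _ => 1, .const 1, fun _ out _ _ _ _ => ⟨.skip, fun s _ h =>
      (Exec.skip le_rfl).congr (fun r => by simp only [Function.update_apply]; grind) le_rfl⟩⟩
  | succ =>
    refine ⟨fun v => 7 * v.head + 3, Primrec.nat_add.comp (Primrec.nat_mul.comp (.const 7)
      .vector_head) (.const 3), fun ins out base hi ho hne =>
      ⟨.seq (copy (ins 0) out base) (.inc out), fun s hs h => ?_⟩⟩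
    have := hi 0
    refine Exec.seq (exec_copy (hne 0) (by omega) (by omega) (hs _ le_rfl)) (.inc le_rfl) le_rfl
      |>.congr (fun r => ?_) ?_
    · simp only [List.Vector.ofFn, List.Vector.head_cons, Function.update_apply]
      grind
    · simp only [List.Vector.ofFn, List.Vector.head_cons]
      omega
  | get i =>
    refine ⟨fun v => 7 * v.get i + 2, Primrec.nat_add.comp (Primrec.nat_mul.comp (.const 7)
      (Primrec.vector_get.comp .id (.const i))) (.const 2), fun ins out base hi ho hne =>
      ⟨copy (ins i) out base, fun s hs h => ?_⟩⟩
    have := hi i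
    refine (exec_copy (hne i) (by omega) (by omega) (hs _ le_rfl)).congr (fun r => ?_) ?_
    · simp only [List.Vector.get_ofFn, h, Nat.zero_add]
    · simp only [List.Vector.get_ofFn, le_refl]
  | comp g _ hg' hf hg => exact computable_comp (fun i => (hg' i).to_prim) hf hg
  | prec hf' hg' hf hg => exact computable_prec hf'.to_prim hg'.to_prim hf hg

/-! ### Computable functions by one unbounded search -/

/-- A computable function is obtained by an unbounded search for a zero of a primitive recursive
function, followed by a primitive recursive function. -/
theorem exists_primrec_search {f : ℕ → ℕ} (hf : _root_.Computable f) :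
    ∃ h u : ℕ → ℕ → ℕ, Primrec₂ h ∧ Primrec₂ u ∧ (∀ t k, h t k ≤ 1) ∧
      (∀ t k, h t k = 0 → u t k = f k) ∧ ∀ k, ∃ t, h t k = 0 := by
  obtain ⟨c, hc⟩ := Nat.Partrec.Code.exists_code.1 (Partrec.nat_iff.1 hf)
  have he : Primrec₂ fun t k => Nat.Partrec.Code.evaln t c k :=
    Nat.Partrec.Code.primrec_evaln.comp (Primrec.pair (Primrec.pair .fst (.const c)) .snd)
  -- The value is 0 exactly when the evaluation of the code with fuel `t` succeeds. Being a flag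
  -- bounded by 1, it can be cleared in constant time in the search loop.
  refine ⟨fun t k => 1 - ((Nat.Partrec.Code.evaln t c k).map fun _ => 1).getD 0,
    fun t k => (Nat.Partrec.Code.evaln t c k).getD 0,
    Primrec.nat_sub.comp (.const 1) (Primrec.option_getD.comp
      (Primrec.option_map he (.const 1)) (.const 0)),
    Primrec.option_getD.comp he (.const 0), fun t k => Nat.sub_le _ _, fun t k ht => ?_,
    fun k => ?_⟩
  · rcases hev : Nat.Partrec.Code.evaln t c k with _ | y
    · simp [hev] at ht
    · have := Nat.Partrec.Code.evaln_sound (Option.mem_def.2 hev)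
      rw [hc] at this
      simpa [hev, eq_comm] using this
  · have : f k ∈ c.eval k := by rw [hc]; simp
    obtain ⟨t, ht⟩ := Nat.Partrec.Code.evaln_complete.1 this
    exact ⟨t, by simp [Option.mem_def.1 ht]⟩

/-- The number of rounds of the search is a computable function of the input, obtained by
minimization, and each round takes primitive recursive time. So the time bound is computable, as the
definition of a $k$-restricted machine requires. -/
theorem exists_exec_of_computable {f : ℕ → ℕ} (hf : _root_.Computable f) :
    ∃ T : ℕ → ℕ, _root_.Computable T ∧ ∀ a out base : ℕ, a < base → out < base → a ≠ out →
      ∃ p : CounterProg, ∀ s : ℕ → ℕ, (∀ r, base ≤ r → s r = 0) → s out = 0 →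
        p.Exec s (T (s a)) (update s out (f (s a))) := by
  obtain ⟨h, u, hh, hu, hle, hu_eq, hex⟩ := exists_primrec_search hf
  let μ : ℕ → ℕ := fun k => Nat.find (hex k)
  have hμ : _root_.Computable μ := by
    have hp : Computable₂ fun k t => decide (h t k = 0) :=
      (Primrec.eq.comp hh (.const 0)).decide.to_comp.comp
        (_root_.Computable.pair .snd .fst)
    refine (Partrec.rfind hp.partrec₂).of_eq fun k => Part.eq_some_iff.2 ?_
    refine Nat.mem_rfind.2 ⟨?_, fun {m} hm => ?_⟩
    · simpa using Nat.find_spec (hex k)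
    · simpa using Nat.find_min (hex k) hm
  obtain ⟨Tu, hTu, hu'⟩ := computable_of_primrec' (Nat.Primrec'.prim_iff₂.2 hu)
  obtain ⟨Th, hTh, hh'⟩ := computable_of_primrec' (Nat.Primrec'.prim_iff₂.2 hh)
  let S : ℕ → ℕ → ℕ := fun k j => j.rec 0 fun i IH => IH + (Th ((i + 1) ::ᵥ k ::ᵥ List.Vector.nil) + 5)
  have hS : Primrec₂ S := .nat_rec (f := fun _ => 0)
    (g := fun (k : ℕ) p => p.2 + (Th ((p.1 + 1) ::ᵥ k ::ᵥ List.Vector.nil) + 5)) (.const 0) <|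
    Primrec.nat_add.comp (Primrec.snd.comp .snd) (Primrec.nat_add.comp (hTh.comp
      (Primrec.vector_cons.comp (Primrec.succ.comp (Primrec.fst.comp .snd))
        (Primrec.vector_cons.comp .fst (.const List.Vector.nil)))) (.const 5))
  refine ⟨fun k => Th (0 ::ᵥ k ::ᵥ List.Vector.nil) + ((S k (μ k) + 1) + (Tu (μ k ::ᵥ k ::ᵥ List.Vector.nil) +
    (2 * μ k + 1))), ?_, ?_⟩
  · have h₁ : Primrec fun k : ℕ => Th (0 ::ᵥ k ::ᵥ List.Vector.nil) := hTh.comp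
      (Primrec.vector_cons.comp (.const 0) (Primrec.vector_cons.comp .id (.const List.Vector.nil)))
    have h₂ : Primrec₂ fun k m : ℕ => (S k m + 1) + (Tu (m ::ᵥ k ::ᵥ List.Vector.nil) + (2 * m + 1)) :=
      Primrec.nat_add.comp (Primrec.succ.comp hS) (Primrec.nat_add.comp (hTu.comp
        (Primrec.vector_cons.comp .snd (Primrec.vector_cons.comp .fst (.const List.Vector.nil))))
        (Primrec.succ.comp (Primrec.nat_mul.comp (.const 2) .snd)))
    exact Primrec.nat_add.to_comp.comp h₁.to_comp (h₂.to_comp.comp .id hμ)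
  intro a out base ha hout hne
  obtain ⟨ph, hph⟩ := hh' ![base, a] (base + 1) (base + 2)
    (Fin.forall_fin_two.2 ⟨by simp, by simp; omega⟩) (by omega)
    (Fin.forall_fin_two.2 ⟨by simp, by simp; omega⟩)
  obtain ⟨pu, hpu⟩ := hu' ![base, a] out (base + 1)
    (Fin.forall_fin_two.2 ⟨by simp, by simp; omega⟩) (by omega)
    (Fin.forall_fin_two.2 ⟨by simp; omega, by simpa using hne⟩)
  refine ⟨.seq ph (.seq (.loop (base + 1) (.seq (clear (base + 1)) (.seq (.inc base) ph)))
    (.seq pu (clear base))), fun s hs hs' => ?_⟩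
  set k := s a with hk
  let st : ℕ → ℕ → ℕ → ℕ := fun t b => update (update s base t) (base + 1) b
  have hin : ∀ t b, (List.Vector.ofFn fun i => st t b ((![base, a] : Fin 2 → ℕ) i)) =
      t ::ᵥ k ::ᵥ List.Vector.nil := by
    intro t b
    have h₁ : a ≠ base := by omega
    have h₂ : a ≠ base + 1 := by omega
    simp [List.Vector.ofFn, st, h₁, h₂, hk]
  have hph' : ∀ t, ph.Exec (st t 0) (Th (t ::ᵥ k ::ᵥ List.Vector.nil)) (st t (h t k)) := by
    intro t
    have := hph (st t 0) (fun r hr => by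
      simp only [st, Function.update_apply]
      grind) (by simp [st])
    rw [hin] at this
    refine this.congr (fun r => ?_) le_rfl
    simp [st]
  have hloop : ∀ j t, t + j = μ k → ∃ T, T + S k t = S k (μ k) + 1 ∧
      (CounterProg.loop (base + 1) (.seq (clear (base + 1)) (.seq (.inc base) ph))).Exec
        (st t (h t k)) T (st (μ k) 0) := by
    intro j
    induction j with
    | zero =>
      rintro t rfl
      have h0 : h (μ k) k = 0 := Nat.find_spec (hex k)
      rw [Nat.add_zero] at *
      rw [h0]
      exact ⟨1, by omega, .loop_done (by simp [st]) le_rfl⟩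
    | succ j ih =>
      intro t ht
      obtain ⟨T, hT, hl⟩ := ih (t + 1) (by omega)
      have h1 : h t k ≠ 0 := Nat.find_min (hex k) (show t < Nat.find (hex k) by
        simp only [μ] at ht; omega)
      have h1' := hle t k
      have hS' : S k (t + 1) = S k t + (Th ((t + 1) ::ᵥ k ::ᵥ List.Vector.nil) + 5) := rfl
      refine ⟨T + (Th ((t + 1) ::ᵥ k ::ᵥ List.Vector.nil) + 5), by omega, .loop_step (by simpa [st] using h1)
        (.seq (s' := st t 0) ((exec_clear _ _).congr (by simp [st]) le_rfl)
          (.seq (s' := st (t + 1) 0) (Exec.inc' ?_ le_rfl) (hph' (t + 1)) le_rfl) le_rfl) hl ?_⟩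
      · intro r
        simp only [st, Function.update_apply]
        grind
      · simp [st]
        omega
  obtain ⟨T, hT, hl⟩ := hloop (μ k) 0 (by simp)
  have hS0 : S k 0 = 0 := rfl
  rw [hS0] at hT
  have hst0 : st 0 0 = s := by
    funext r
    simp only [st, Function.update_apply]
    grind
  have h0 := hph' 0
  rw [hst0] at h0
  have hu₁ := hpu (st (μ k) 0) (fun r hr => by
    simp only [st, Function.update_apply]
    grind) (by
    simp only [st, Function.update_apply]
    grind)
  rw [hin] at hu₁
  have hμ0 : u (μ k) k = f k := hu_eq _ _ (Nat.find_spec (hex k))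
  refine Exec.seq h0 (.seq (hl.mono hT.le) (.seq hu₁ (exec_clear _ _) le_rfl) le_rfl) le_rfl
    |>.congr (fun r => ?_) ?_
  · simp only [List.Vector.head_cons, List.Vector.tail_cons, hμ0, st, Function.update_apply]
    grind
  · have h₁ : base ≠ out := by omega
    simp [st, h₁]

/-! ### Computing the number of bits to be guessed -/

/-- Replace `n` by `0` and add to `l` the binary logarithm of `n`, with the help of an empty
register `h`; `l` has to be empty. -/
def log2 (n l h : ℕ) : CounterProg :=
  seq (loop n (seq (dec n) (seq (loop n (seq (dec n) (seq (dec n) (inc h))))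
    (seq (move h n) (inc l))))) (dec l)

/-- Decrementing is truncated at 0, so an odd value is rounded up. In `log2` one decrement precedes
this loop, which turns the result into the rounded-down half. -/
theorem exec_halve {n h : ℕ} (hnh : n ≠ h) (s : ℕ → ℕ) :
    (loop n (seq (dec n) (seq (dec n) (inc h)))).Exec s (4 * s n + 1)
      (update (update s h (s h + (s n + 1) / 2)) n 0) := by
  generalize hm : s n = m
  induction m using Nat.strong_induction_on generalizing s with
  | _ m ih =>
    rcases Nat.eq_zero_or_pos m with rfl | hpos
    · refine (Exec.loop_done hm le_rfl).congr (fun r => ?_) (by omega)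
      simp only [Function.update_apply]
      grind
    · refine (Exec.loop_step (by omega) (.seq (.dec le_rfl) (.seq (.dec le_rfl) (.inc le_rfl)
        le_rfl) le_rfl) (ih (m - 1 - 1) (by omega) _ (by simp [hnh, hm])) le_rfl).congr
        (fun r => ?_) (by omega)
      simp only [Function.update_apply]
      grind

/-- A positive number can be halved one more time than its logarithm before it becomes 0, and 0 not
at all. The truncated decrement at the end corrects both cases, in accordance with $\log 0=0$. -/
theorem exec_log2 {n l h : ℕ} (hnl : n ≠ l) (hnh : n ≠ h) (hlh : l ≠ h) {s : ℕ → ℕ}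
    (hh : s h = 0) (hl : s l = 0) :
    (log2 n l h).Exec s (22 * s n + 2) (update (update s l (Nat.log 2 (s n))) n 0) := by
  have key : ∀ (m : ℕ) (s : ℕ → ℕ), s n = m → s h = 0 →
      (loop n (seq (dec n) (seq (loop n (seq (dec n) (seq (dec n) (inc h))))
        (seq (move h n) (inc l))))).Exec s (22 * m + 1)
        (update (update s l (s l + if m = 0 then 0 else Nat.log 2 m + 1)) n 0) := by
    intro m
    induction m using Nat.strong_induction_on with
    | _ m ih =>
      intro s hm hh
      rcases Nat.eq_zero_or_pos m with rfl | hpos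
      · refine (Exec.loop_done hm le_rfl).congr (fun r => ?_) (by omega)
        simp only [Function.update_apply]
        grind
      · have hb : (seq (dec n) (seq (loop n (seq (dec n) (seq (dec n) (inc h))))
            (seq (move h n) (inc l)))).Exec s (6 * m + 4)
              (update (update s n (m / 2)) l (s l + 1)) := by
          refine (Exec.seq (.dec le_rfl) (.seq (exec_halve hnh _) (.seq (exec_move hnh.symm _)
            (.inc le_rfl) le_rfl) le_rfl) le_rfl).congr (fun r => ?_) ?_
          · simp only [Function.update_apply]
            grind
          · simp [hnh.symm, hm, hh]
            omega
        refine (Exec.loop_step (by omega) hb (ih (m / 2) (by omega) _ (by simp [hnl])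
          (by simp [hnh.symm, hlh.symm, hh])) le_rfl).congr (fun r => ?_) (by omega)
        have hlog : Nat.log 2 m = if m / 2 = 0 then 0 else Nat.log 2 (m / 2) + 1 := by
          split_ifs with h2
          · exact Nat.log_of_lt (by omega)
          · exact Nat.log_of_one_lt_of_le one_lt_two (by omega)
        simp only [Function.update_apply, hpos.ne', if_false, hlog]
        grind
  refine (Exec.seq (key _ s rfl hh) (.dec le_rfl) le_rfl).congr (fun r => ?_) (by omega)
  have : s n = 0 → Nat.log 2 (s n) = 0 := fun h => by simp [h]
  simp only [Function.update_apply]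
  grind

/-- Add to `c` the product of `a` and `b`, emptying `a`, with the help of an empty register `d`. -/
def mul (a b c d : ℕ) : CounterProg := loop a (seq (dec a) (copy b c d))

theorem exec_mul {a b c d : ℕ} (hab : a ≠ b) (hac : a ≠ c) (had : a ≠ d) (hbc : b ≠ c)
    (hbd : b ≠ d) (hcd : c ≠ d) {s : ℕ → ℕ} (hd : s d = 0) :
    (mul a b c d).Exec s (s a * (7 * s b + 4) + 1)
      (update (update s c (s c + s a * s b)) a 0) := by
  generalize hn : s a = n
  induction n generalizing s with
  | zero =>
    refine (Exec.loop_done hn le_rfl).congr (fun r => ?_) (by omega)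
    simp only [Function.update_apply]
    grind
  | succ n ih =>
    refine (Exec.loop_step (by omega) (.seq (.dec le_rfl) (exec_copy hbc hbd hcd
      (by simp [had.symm, hd])) le_rfl) (ih (by simp [had.symm, hcd.symm, hd])
      (by simp [hac, hn])) le_rfl).congr (fun r => ?_) ?_
    · simp only [Function.update_apply]
      grind
    · simp [hab.symm, hbc]
      ring_nf
      omega

theorem exists_exec_mul_log {f : ℕ → ℕ} (hf : _root_.Computable f) :
    ∃ (T : ℕ → ℕ) (p : CounterProg), _root_.Computable T ∧ ∀ k n : ℕ, ∃ s' : ℕ → ℕ,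
      p.Exec (update (update (fun _ => 0) 0 k) 1 n)
        (T k + (22 * n + 2) + (f k * (7 * Nat.log 2 n + 4) + 1)) s' ∧
      s' 5 = f k * Nat.log 2 n := by
  obtain ⟨T, hT, h⟩ := exists_exec_of_computable hf
  -- Registers: 0 holds `k`, 1 holds `n`, 2 receives the logarithm, 3 is an auxiliary register, 4
  -- receives `f k` and 5 the product; those from 6 on are scratch space.
  obtain ⟨p, hp⟩ := h 0 4 6 (by omega) (by omega) (by omega)
  refine ⟨T, .seq (log2 1 2 3) (.seq p (mul 4 2 5 3)), hT, fun k n => ?_⟩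
  have h₁ := exec_log2 (n := 1) (l := 2) (h := 3) (s := update (update (fun _ => 0) 0 k) 1 n)
    (by omega) (by omega) (by omega) (by simp) (by simp)
  simp only [Function.update_self] at h₁
  have h₂ := hp (update (update (update (update (fun _ => 0) 0 k) 1 n) 2 (Nat.log 2 n)) 1 0) ?_ ?_
  · refine ⟨_, Exec.seq h₁ (.seq h₂ (exec_mul (by omega) (by omega) (by omega) (by omega)
      (by omega) (by omega) (by simp)) le_rfl) ?_, ?_⟩
    · simp
      omega
    · simp
  · intro r hr
    simp only [Function.update_apply]
    grind
  · simp

end CounterProg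

/-! ### Simulating a machine by a stack program -/

/-- The auxiliary stacks of a simulating machine. -/
inductive AuxStack (m : ℕ) : Type
  | inp
  | tmp
  | bits
  | word
  | reg (i : Fin m)
  deriving DecidableEq

instance (m : ℕ) : Finite (AuxStack m) :=
  Finite.of_surjective (fun x : Fin m ⊕ Fin 4 => x.elim AuxStack.reg
    ![.inp, .tmp, .bits, .word]) fun
    | .inp => ⟨.inr 0, rfl⟩
    | .tmp => ⟨.inr 1, rfl⟩
    | .bits => ⟨.inr 2, rfl⟩
    | .word => ⟨.inr 3, rfl⟩
    | .reg i => ⟨.inl i, rfl⟩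

/-- The letters on the auxiliary stacks: a letter of a string `⟨x, y⟩`, or the additional
symbol `none`. -/
abbrev AuxLetter (A : Type) : Type := Option (A ⊕ Bool)

/-- The bit that is represented by a letter. -/
def AuxLetter.toBool {A : Type} : Option (AuxLetter A) → Bool
  | some (some (.inr b)) => b
  | _ => false

/-- The control state of a simulating machine: label and internal state of the simulated machine,
the letter that was read last, and possibly a decision that overrides the simulated one. -/
structure SimControl (A Λ σ : Type) : Type where
  lab : Option Λ
  var : σ
  cur : Option (AuxLetter A)
  verdict : Option Bool

instance {A Λ σ : Type} [Finite A] [Finite Λ] [Finite σ] : Finite (SimControl A Λ σ) :=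
  Finite.of_injective (fun s => (s.lab, s.var, s.cur, s.verdict)) fun
    | ⟨_, _, _, _⟩, ⟨_, _, _, _⟩, h => by simpa using h

namespace NTM

open StackProg

variable {A A' : Type} (N : NTM A') (m : ℕ)

/-- The stack alphabets of a machine that simulates `N`. -/
abbrev SimΓ (A : Type) {A' : Type} (N : NTM A') (m : ℕ) : N.K ⊕ AuxStack m → Type :=
  Sum.elim N.Γ fun _ => AuxLetter A

instance [Finite A] (k : N.K ⊕ AuxStack m) : Finite (SimΓ A N m k) := by
  cases k
  · exact inferInstanceAs (Finite (N.Γ _))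
  · exact inferInstanceAs (Finite (AuxLetter A))

/-- Programs for the simulation of `N`. -/
abbrev SimProg (A : Type) {A' : Type} (N : NTM A') (m : ℕ) : Type :=
  StackProg (SimΓ A N m) (SimControl A N.Λ N.σ)

variable {N m}

/-- The stacks of `N` together with auxiliary stacks. -/
def joinStk (S : ∀ k, List (N.Γ k)) (a : AuxStack m → List (AuxLetter A)) :
    ∀ k, List (SimΓ A N m k)
  | .inl k => S k
  | .inr j => a j

theorem update_joinStk_inl (S : ∀ k, List (N.Γ k)) (a : AuxStack m → List (AuxLetter A))
    (k : N.K) (l : List (N.Γ k)) :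
    Function.update (joinStk S a) (.inl k) l = joinStk (Function.update S k l) a := by
  funext i
  rcases i with i | j
  · by_cases h : i = k
    · subst h
      exact (Function.update_self ..).trans (Function.update_self (f := S) ..).symm
    · exact (Function.update_of_ne (by simpa using h) _ _).trans
        (Function.update_of_ne (f := S) h _).symm
  · exact Function.update_of_ne (by simp) _ _

theorem update_joinStk_inr (S : ∀ k, List (N.Γ k)) (a : AuxStack m → List (AuxLetter A))
    (j : AuxStack m) (l : List (AuxLetter A)) :
    Function.update (joinStk S a) (.inr j) l = joinStk S (Function.update a j l) := by
  funext i
  rcases i with i | i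
  · exact Function.update_of_ne (by simp) _ _
  · by_cases h : i = j
    · subst h
      exact (Function.update_self ..).trans (Function.update_self (f := a) ..).symm
    · exact (Function.update_of_ne (by simpa using h) _ _).trans
        (Function.update_of_ne (f := a) h _).symm

/-- The memory of the simulating machine. -/
def simMem (c : N.Cfg) (cur : Option (AuxLetter A)) (vd : Option Bool)
    (a : AuxStack m → List (AuxLetter A)) :
    SimControl A N.Λ N.σ × (∀ k, List (SimΓ A N m k)) :=
  (⟨c.l, c.var, cur, vd⟩, joinStk c.stk a)

/-- The contents of the auxiliary stacks; a register is a stack of symbols `none`. -/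
def auxStk (i t b w : List (AuxLetter A)) (r : ℕ → ℕ) : AuxStack m → List (AuxLetter A)
  | .inp => i
  | .tmp => t
  | .bits => b
  | .word => w
  | .reg j => List.replicate (r j) none

section update

variable (i t b w l : List (AuxLetter A)) (r : ℕ → ℕ)

theorem update_auxStk_inp :
    Function.update (auxStk (m := m) i t b w r) .inp l = auxStk l t b w r := by
  funext j; cases j <;> simp [auxStk]

theorem update_auxStk_tmp :
    Function.update (auxStk (m := m) i t b w r) .tmp l = auxStk i l b w r := by
  funext j; cases j <;> simp [auxStk]

theorem update_auxStk_bits :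
    Function.update (auxStk (m := m) i t b w r) .bits l = auxStk i t l w r := by
  funext j; cases j <;> simp [auxStk]

theorem update_auxStk_word :
    Function.update (auxStk (m := m) i t b w r) .word l = auxStk i t b l r := by
  funext j; cases j <;> simp [auxStk]

theorem update_auxStk_reg (j : Fin m) (n : ℕ) :
    Function.update (auxStk (m := m) i t b w r) (.reg j) (List.replicate n none) =
      auxStk i t b w (Function.update r j n) := by
  funext j'
  cases j' with
  | reg j' =>
    by_cases h : j' = j
    · subst h; simp [auxStk]
    · simp [auxStk, h, Fin.val_inj]
  | _ => simp [auxStk]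

end update

/-- Pop from an auxiliary stack and remember the letter. -/
def popAux (j : AuxStack m) : SimProg A N m :=
  .op (.pop (.inr j) fun s g => { s with cur := g })

/-- Read the top of an auxiliary stack and remember the letter. -/
def peekAux (j : AuxStack m) : SimProg A N m :=
  .op (.peek (.inr j) fun s g => { s with cur := g })

/-- Push a letter onto an auxiliary stack. -/
def pushAux (j : AuxStack m) (g : AuxLetter A) : SimProg A N m :=
  .op (.push (.inr j) fun _ => g)

/-- Push a letter onto the input stack of `N`. -/
def pushInput (g : Option A') : SimProg A N m :=
  .op (.push (.inl N.k₀) fun _ => N.emb g)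

/-- The configuration with a letter pushed onto the input stack. -/
def pushCfg (c : N.Cfg) (l : List (Option A')) : N.Cfg :=
  ⟨c.l, c.var, Function.update c.stk N.k₀ (l.map N.emb ++ c.stk N.k₀)⟩

theorem pushCfg_nil (c : N.Cfg) : pushCfg c [] = c := by simp [pushCfg]

theorem pushCfg_pushCfg (c : N.Cfg) (l l' : List (Option A')) :
    pushCfg (pushCfg c l) l' = pushCfg c (l' ++ l) := by simp [pushCfg]

variable {c c' : N.Cfg} {cur cur' : Option (AuxLetter A)} {vd vd' : Option Bool}
  {a a' : AuxStack m → List (AuxLetter A)} {t : ℕ}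

theorem exec_popAux (j : AuxStack m) (ht : 1 ≤ t) :
    (popAux j).Exec (simMem c cur vd a) t []
      (simMem c (a j).head? vd (Function.update a j (a j).tail)) :=
  .op' (by simp [StackOp.apply, simMem, joinStk, update_joinStk_inr]) ht

theorem exec_peekAux (j : AuxStack m) (ht : 1 ≤ t) :
    (peekAux j).Exec (simMem c cur vd a) t [] (simMem c (a j).head? vd a) :=
  .op' (by simp [StackOp.apply, simMem, joinStk]) ht

theorem exec_pushAux (j : AuxStack m) (g : AuxLetter A) (ht : 1 ≤ t) :
    (pushAux j g).Exec (simMem c cur vd a) t []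
      (simMem c cur vd (Function.update a j (g :: a j))) :=
  .op' (by simp [StackOp.apply, simMem, joinStk, update_joinStk_inr]) ht

theorem exec_pushInput (g : Option A') (ht : 1 ≤ t) :
    (pushInput g).Exec (simMem c cur vd a) t [] (simMem (pushCfg c [g]) cur vd a) :=
  .op' (by simp [StackOp.apply, simMem, joinStk, update_joinStk_inl, pushCfg]) ht

/-- Empty an auxiliary stack, running a program for each letter. -/
def drain (j : AuxStack m) (body : AuxLetter A → SimProg A N m) : SimProg A N m :=
  .seq (popAux j) (.loop (fun s => s.cur.isSome)
    (.seq (.choose fun s => s.cur.elim skip body) (popAux j)))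

theorem noCoin_drain (j : AuxStack m) {body : AuxLetter A → SimProg A N m}
    (h : ∀ g, (body g).NoCoin) : (drain j body).NoCoin := by
  refine ⟨trivial, ⟨fun s => ?_, trivial⟩⟩
  show (s.cur.elim skip body).NoCoin
  rcases s.cur with _ | g
  · trivial
  · exact h g

theorem exec_drain_nil {j : AuxStack m} {body : AuxLetter A → SimProg A N m} (hj : a j = [])
    (ht : 2 ≤ t) : (drain j body).Exec (simMem c cur vd a) t [] (simMem c none vd a) := by
  have h := exec_popAux (c := c) (cur := cur) (vd := vd) (a := a) j le_rfl
  rw [hj, List.tail_nil, ← hj, Function.update_eq_self] at h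
  rw [hj] at h
  exact Exec.mono (.seq_nil h (.loop_done (t := 1) rfl le_rfl) le_rfl) ht

theorem exec_drain_cons {j : AuxStack m} {body : AuxLetter A → SimProg A N m}
    {g : AuxLetter A} {l : List (AuxLetter A)} {d T : ℕ} {w w' : List Bool}
    {M : SimControl A N.Λ N.σ × (∀ k, List (SimΓ A N m k))} (hj : a j = g :: l)
    (h : (body g).Exec (simMem c (some g) vd (Function.update a j l)) d w
      (simMem c' cur' vd' a'))
    (h' : (drain j body).Exec (simMem c' cur' vd' a') t w' M) (hT : d + 3 + t ≤ T) :
    (drain j body).Exec (simMem c cur vd a) T (w ++ w') M := by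
  have h₀ := exec_popAux (c := c) (cur := cur) (vd := vd) (a := a) j le_rfl
  rw [hj] at h₀
  -- The execution on the rest begins with a pop. That pop becomes the end of the loop body for the
  -- letter `g`, and what follows it is the remaining loop.
  cases h' with
  | @seq _ _ _ m' _ t₁ t₂ _ w₁ w₂ h₁ h₂ ht =>
    cases h₁ with
    | op ht₁ =>
      have := (Exec.loop_step (c := fun s : SimControl A N.Λ N.σ => s.cur.isSome)
        (m := simMem c (some g) vd (Function.update a j l)) rfl
        (.seq (.choose (f := fun s => s.cur.elim skip body) h le_rfl) (.op le_rfl) le_rfl)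
        h₂ le_rfl)
      have := Exec.seq h₀ this (T := T) (by omega)
      rwa [List.append_nil, List.nil_append] at this

theorem exec_drain_cons_nil {j : AuxStack m} {body : AuxLetter A → SimProg A N m}
    {g : AuxLetter A} {l : List (AuxLetter A)} {d T : ℕ}
    {M : SimControl A N.Λ N.σ × (∀ k, List (SimΓ A N m k))} (hj : a j = g :: l)
    (h : (body g).Exec (simMem c (some g) vd (Function.update a j l)) d []
      (simMem c' cur' vd' a'))
    (h' : (drain j body).Exec (simMem c' cur' vd' a') t [] M) (hT : d + 3 + t ≤ T) :
    (drain j body).Exec (simMem c cur vd a) T [] M :=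
  exec_drain_cons (w := []) (w' := []) hj h h' hT

theorem exec_transfer {j j' : AuxStack m} (hne : j ≠ j') (l : List (AuxLetter A))
    (cur : Option (AuxLetter A)) (a : AuxStack m → List (AuxLetter A)) (ha : a j = l) :
    (drain j (pushAux j')).Exec (simMem c cur vd a) (4 * l.length + 2) []
      (simMem c none vd (Function.update (Function.update a j []) j' (l.reverse ++ a j'))) := by
  induction l generalizing a cur with
  | nil =>
    rw [List.reverse_nil, List.nil_append, ← ha, Function.update_eq_self, Function.update_eq_self]
    exact exec_drain_nil ha (by omega)
  | cons g l ih =>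
    have h := ih (some g) (Function.update (Function.update a j l) j' (g :: a j'))
      (by rw [Function.update_of_ne hne, Function.update_self])
    rw [Function.update_self, Function.update_comm hne.symm, Function.update_idem,
      Function.update_idem] at h
    rw [List.reverse_cons, List.append_assoc]
    refine exec_drain_cons_nil (d := 1) ha ?_ h (by simp; omega)
    have := exec_pushAux (c := c) (cur := some g) (vd := vd) (a := Function.update a j l) j' g
      le_rfl
    rwa [Function.update_of_ne hne.symm] at this

theorem exec_transfer_inp {b w : List (AuxLetter A)} {r : ℕ → ℕ} (l : List (AuxLetter A)) :
    (drain (m := m) .inp (pushAux .tmp)).Exec (simMem c cur vd (auxStk l [] b w r))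
      (4 * l.length + 2) [] (simMem c none vd (auxStk [] l.reverse b w r)) := by
  have h := exec_transfer (c := c) (vd := vd) (j := .inp) (j' := .tmp) (by simp) l cur
    (auxStk (m := m) l [] b w r) rfl
  have e : l.reverse ++ auxStk (m := m) l [] b w r .tmp = l.reverse := List.append_nil _
  rwa [update_auxStk_inp, update_auxStk_tmp, e] at h

theorem exec_transfer_word {i b : List (AuxLetter A)} {r : ℕ → ℕ} (l : List (AuxLetter A)) :
    (drain (m := m) .word (pushAux .tmp)).Exec (simMem c cur vd (auxStk i [] b l r))
      (4 * l.length + 2) [] (simMem c none vd (auxStk i l.reverse b [] r)) := by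
  have h := exec_transfer (c := c) (vd := vd) (j := .word) (j' := .tmp) (by simp) l cur
    (auxStk (m := m) i [] b l r) rfl
  have e : l.reverse ++ auxStk (m := m) i [] b l r .tmp = l.reverse := List.append_nil _
  rwa [update_auxStk_word, update_auxStk_tmp, e] at h

theorem exec_drain_pushInput {A : Type} {N : NTM (A ⊕ Bool)} {j : AuxStack m}
    (l : List (AuxLetter A)) (cur : Option (AuxLetter A)) (c : N.Cfg)
    (a : AuxStack m → List (AuxLetter A)) (ha : a j = l) :
    (drain j pushInput).Exec (simMem c cur vd a) (4 * l.length + 2) []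
      (simMem (pushCfg c l.reverse) none vd (Function.update a j [])) := by
  induction l generalizing a cur c with
  | nil =>
    rw [List.reverse_nil, pushCfg_nil, ← ha, Function.update_eq_self]
    exact exec_drain_nil ha (by omega)
  | cons g l ih =>
    have h := ih (some g) (pushCfg c [g]) (Function.update a j l) (Function.update_self ..)
    rw [Function.update_idem, pushCfg_pushCfg, ← List.reverse_cons] at h
    exact exec_drain_cons_nil (d := 1) ha (exec_pushInput g le_rfl) h (by simp; omega)

/-- Distribute a string `⟨x, y⟩` and the parameter to the input stack of `N` and the stack of
bits. -/
def unpair {N : NTM A} : AuxLetter A → SimProg A N m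
  | none => pushInput none
  | some (.inl z) => pushInput (some z)
  | some (.inr b) => pushAux .bits (some (.inr b))

/-- The letters of the input of the simulated machine. -/
def unpairInput : AuxLetter A → Option (Option A)
  | none => some none
  | some (.inl z) => some (some z)
  | some (.inr _) => none

/-- The bits in a string. -/
def unpairBits : AuxLetter A → Option Bool
  | some (.inr b) => some b
  | _ => none

theorem exec_unpair {N : NTM A} {w i : List (AuxLetter A)} {r : ℕ → ℕ} (l : List (AuxLetter A))
    (cur : Option (AuxLetter A)) (c : N.Cfg) (b : List Bool) :
    (drain (m := m) .tmp unpair).Exec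
      (simMem c cur vd (auxStk i l (b.map fun b => some (.inr b)) w r)) (4 * l.length + 2) []
      (simMem (pushCfg c (l.filterMap unpairInput).reverse) none vd
        (auxStk i [] (((l.filterMap unpairBits).reverse ++ b).map fun b => some (.inr b)) w r)) := by
  induction l generalizing cur c b with
  | nil =>
    rw [List.filterMap_nil, List.filterMap_nil, List.reverse_nil, List.reverse_nil, pushCfg_nil]
    exact exec_drain_nil rfl le_rfl
  | cons g l ih =>
    rcases g with _ | z | b'
    · have h := ih (some none) (pushCfg c [none]) b
      rw [pushCfg_pushCfg, ← List.reverse_cons] at h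
      refine exec_drain_cons_nil (d := 1) rfl ?_ h (by simp; omega)
      rw [update_auxStk_tmp]
      exact exec_pushInput none le_rfl
    · have h := ih (some (some (.inl z))) (pushCfg c [some z]) b
      rw [pushCfg_pushCfg, ← List.reverse_cons] at h
      refine exec_drain_cons_nil (d := 1) rfl ?_ h (by simp; omega)
      rw [update_auxStk_tmp]
      exact exec_pushInput (some z) le_rfl
    · have h := ih (some (some (.inr b'))) c (b' :: b)
      rw [List.append_cons, ← List.reverse_cons] at h
      refine exec_drain_cons_nil (d := 1) rfl ?_ h (by simp; omega)
      have := exec_pushAux (c := c) (cur := some (some (.inr b'))) (vd := vd)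
        (a := auxStk i l (b.map fun b => some (.inr b)) w r) (.bits : AuxStack m)
        (some (.inr b')) le_rfl
      rw [update_auxStk_bits] at this
      rw [update_auxStk_tmp]
      exact this

theorem noCoin_unpair {N : NTM A} (g : AuxLetter A) : (unpair (N := N) (m := m) g).NoCoin := by
  rcases g with _ | z | b <;> trivial

/-- The translation of a counter program; the registers are stacks. -/
def counterProg (N : NTM A') (m : ℕ) : CounterProg → SimProg A N m
  | .skip => skip
  | .inc r => if h : r < m then pushAux (.reg ⟨r, h⟩) none else skip
  | .dec r => if h : r < m then popAux (.reg ⟨r, h⟩) else skip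
  | .seq p q => .seq (counterProg N m p) (counterProg N m q)
  | .loop r p =>
    if h : r < m then
      .seq (peekAux (.reg ⟨r, h⟩)) (.loop (fun s => s.cur.isSome)
        (.seq (counterProg N m p) (peekAux (.reg ⟨r, h⟩))))
    else skip

theorem exec_counterProg {i tm b w : List (AuxLetter A)} {p : CounterProg} {s s' : ℕ → ℕ}
    (h : p.Exec s t s') (hp : p.width ≤ m) (cur : Option (AuxLetter A)) :
    ∃ cur', (counterProg N m p).Exec (simMem c cur vd (auxStk i tm b w s)) (4 * t) []
      (simMem c cur' vd (auxStk i tm b w s')) := by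
  induction h generalizing cur with
  | skip ht => exact ⟨_, .skip (by omega)⟩
  | @inc r s t ht =>
    have hr : r < m := hp
    refine ⟨cur, ?_⟩
    rw [counterProg, dif_pos hr, ← update_auxStk_reg (j := ⟨r, hr⟩), List.replicate_succ]
    exact exec_pushAux _ _ (by omega)
  | @dec r s t ht =>
    have hr : r < m := hp
    refine ⟨(List.replicate (s r) none).head?, ?_⟩
    rw [counterProg, dif_pos hr, ← update_auxStk_reg (j := ⟨r, hr⟩), ← List.tail_replicate]
    exact exec_popAux _ (by omega)
  | seq _ _ ht ih ih' =>
    obtain ⟨cur₁, h₁⟩ := ih (le_trans (le_max_left _ _) hp) cur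
    obtain ⟨cur₂, h₂⟩ := ih' (le_trans (le_max_right _ _) hp) cur₁
    exact ⟨cur₂, .seq_nil h₁ h₂ (by omega)⟩
  | @loop_done r p s t hs ht =>
    have hr : r < m := le_trans (le_max_left _ _) hp
    have h := exec_peekAux (c := c) (cur := cur) (vd := vd) (a := auxStk i tm b w s)
      (.reg ⟨r, hr⟩) le_rfl
    refine ⟨(auxStk (m := m) i tm b w s (.reg ⟨r, hr⟩)).head?, ?_⟩
    rw [counterProg, dif_pos hr]
    exact .seq_nil h (.loop_done (t := 1) (by simp [auxStk, hs, simMem]) le_rfl) (by omega)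
  | @loop_step r p s s' s'' t t' T hs _ _ ht ih ih' =>
    have hr : r < m := le_trans (le_max_left _ _) hp
    have h := exec_peekAux (c := c) (cur := cur) (vd := vd) (a := auxStk i tm b w s)
      (.reg ⟨r, hr⟩) le_rfl
    obtain ⟨cur₁, h₁⟩ := ih (le_trans (le_max_right _ _) hp)
      (auxStk (m := m) i tm b w s (.reg ⟨r, hr⟩)).head?
    obtain ⟨cur₂, h₂⟩ := ih' hp cur₁
    refine ⟨cur₂, ?_⟩
    rw [counterProg, dif_pos hr] at h₂ ⊢
    -- The induction hypothesis for the remaining rounds begins with a peek at the register.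
    -- Inversion separates it from the loop, so that it can serve as the peek at the end of the
    -- current round.
    generalize hw : ([] : List Bool) = w₀ at h₂
    cases h₂ with
    | @seq _ _ _ m' _ t₁ t₂ _ w₁ w₂ h₃ h₄ ht' =>
      cases h₃ with
      | op ht₁ =>
        rw [List.nil_append] at hw
        subst hw
        refine .seq_nil h (.loop_step_nil ?_ (.seq_nil h₁ (.op le_rfl) le_rfl) h₄ le_rfl)
          (by omega)
        obtain ⟨n, hn⟩ := Nat.exists_eq_succ_of_ne_zero hs
        simp [auxStk, simMem, hn, List.replicate_succ]

/-- The program that distributes an instance `(x, k)`: the parameter goes to the input stack of `N`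
and, in unary, to the first register; the string `x` to the stack of words and its length, in
unary, to the second register. -/
def distribute (N : NTM A') (hm : 2 ≤ m) : AuxLetter A → SimProg A N m
  | none => .seq (pushInput none) (pushAux (.reg ⟨0, by omega⟩) none)
  | some z => .seq (pushAux .word (some z)) (pushAux (.reg ⟨1, by omega⟩) none)

/-- The registers with contents `k` and `n` in the first two of them. -/
def twoRegs (k n : ℕ) : ℕ → ℕ := Function.update (Function.update (fun _ => 0) 0 k) 1 n

theorem exec_distribute_some (hm : 2 ≤ m) {i b : List (AuxLetter A)} {k : ℕ}
    (l : List (A ⊕ Bool)) (cur : Option (AuxLetter A)) (w : List (AuxLetter A)) (n : ℕ) :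
    (drain .tmp (distribute N hm)).Exec
      (simMem c cur vd (auxStk i (l.map some) b w (twoRegs k n))) (5 * l.length + 2) []
      (simMem c none vd (auxStk i [] b ((l.map some).reverse ++ w)
        (twoRegs k (n + l.length)))) := by
  induction l generalizing cur w n with
  | nil => exact exec_drain_nil rfl (by omega)
  | cons z l ih =>
    have h := ih (some (some z)) (some z :: w) (n + 1)
    rw [List.append_cons, ← List.reverse_cons, ← List.map_cons, Nat.add_assoc, Nat.add_comm 1,
      ← List.length_cons (a := z)] at h
    refine exec_drain_cons_nil (d := 2) rfl ?_ h (by simp; omega)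
    rw [update_auxStk_tmp]
    refine .seq_nil (exec_pushAux .word (some z) le_rfl) (t' := 1) ?_ le_rfl
    have := exec_pushAux (c := c) (cur := some (some z)) (vd := vd)
      (a := auxStk i (l.map some) b (some z :: w) (twoRegs k n))
      (.reg ⟨1, by omega⟩ : AuxStack m) none le_rfl
    simp only [auxStk, ← List.replicate_succ] at this
    rw [update_auxStk_reg, show Function.update (twoRegs k n) ((⟨1, by omega⟩ : Fin m) : ℕ)
      (twoRegs k n 1 + 1) = twoRegs k (n + 1) by simp [twoRegs]] at this
    rw [update_auxStk_word]
    exact this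

/-- After the transfer from the input stack the instance is reversed, so the unary parameter comes
first. It goes to the bottom of the input stack of `N`, while the letters are kept aside until the
guessed bits have been placed above the parameter. -/
theorem exec_distribute (hm : 2 ≤ m) {i b : List (AuxLetter A)} (k' : ℕ)
    (l : List (A ⊕ Bool)) (cur : Option (AuxLetter A)) (c : N.Cfg) (k : ℕ) :
    (drain .tmp (distribute N hm)).Exec
      (simMem c cur vd (auxStk i (List.replicate k' none ++ l.map some) b [] (twoRegs k 0)))
      (5 * (k' + l.length) + 2) []
      (simMem (pushCfg c (List.replicate k' none)) none vd
        (auxStk i [] b (l.map some).reverse (twoRegs (k + k') l.length))) := by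
  induction k' generalizing cur c k with
  | zero =>
    have := exec_distribute_some (c := c) (vd := vd) hm (i := i) (b := b) (k := k) l cur [] 0
    simpa [pushCfg_nil] using this
  | succ k' ih =>
    have h := ih (some none) (pushCfg c [none]) (k + 1)
    rw [pushCfg_pushCfg, ← List.replicate_succ', Nat.add_assoc, Nat.add_comm 1] at h
    refine exec_drain_cons_nil (d := 2) rfl ?_ h (by omega)
    refine .seq_nil (exec_pushInput none le_rfl) (t' := 1) ?_ le_rfl
    have := exec_pushAux (c := pushCfg c [none]) (cur := some none) (vd := vd)
      (a := auxStk i (List.replicate k' none ++ l.map some) b [] (twoRegs k 0))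
      (.reg ⟨0, by omega⟩ : AuxStack m) none le_rfl
    simp only [auxStk, ← List.replicate_succ] at this
    rw [update_auxStk_reg, show Function.update (twoRegs k 0) ((⟨0, by omega⟩ : Fin m) : ℕ)
      (twoRegs k 0 0 + 1) = twoRegs (k + 1) 0 by
        simp [twoRegs, Function.update_comm (show (1 : ℕ) ≠ 0 by omega)]] at this
    rw [update_auxStk_tmp]
    exact this

/-- Guess a bit for each symbol in a register. -/
def guess (N : NTM A') (j : Fin m) : SimProg A N m :=
  drain (.reg j) fun _ => .seq (.coin fun b s => { s with cur := some (some (.inr b)) })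
    (.op (.push (.inr .bits) fun s => s.cur.getD none))

theorem exec_guess {i tm w : List (AuxLetter A)} (j : Fin m) (y : List Bool) (r : ℕ → ℕ)
    (cur : Option (AuxLetter A)) (b : List Bool) (hr : r j = y.length) :
    (guess N j).Exec (simMem c cur vd (auxStk i tm (b.map fun b => some (.inr b)) w r))
      (5 * y.length + 2) y
      (simMem c none vd (auxStk i tm ((y.reverse ++ b).map fun b => some (.inr b)) w
        (Function.update r j 0))) := by
  induction y generalizing r cur b with
  | nil =>
    rw [← List.length_nil (α := Bool), ← hr, Function.update_eq_self]
    exact exec_drain_nil (by simp [auxStk, hr]) (by omega)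
  | cons z y ih =>
    have h := ih (Function.update r j y.length) (some (some (.inr z))) (z :: b) (by simp)
    rw [List.append_cons, ← List.reverse_cons, Function.update_idem] at h
    refine exec_drain_cons (w := [z]) (d := 2) (g := none)
      (l := List.replicate y.length none) (by simp [auxStk, hr, List.replicate_succ]) ?_ h
      (by simp; omega)
    rw [update_auxStk_reg]
    refine Exec.seq (w := [z]) (w' := []) (.coin z le_rfl) (t' := 1)
      (.op' (m' := simMem c (some (some (.inr z))) vd _) ?_ le_rfl) le_rfl
    exact congrArg (Prod.mk _) ((update_joinStk_inr c.stk (auxStk i tm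
      (b.map fun b => some (.inr b)) w (Function.update r j y.length)) .bits
      ((z :: b).map fun b => some (.inr b))).trans (by rw [update_auxStk_bits]))

/-- The translation of a statement of the simulated machine. -/
def stmtProg (A : Type) (N : NTM A') (m : ℕ) : Turing.TM2.Stmt N.Γ N.Λ N.σ → SimProg A N m
  | .push k f q => .seq (.op (.push (.inl k) fun s => f s.var)) (stmtProg A N m q)
  | .peek k f q =>
    .seq (.op (.peek (.inl k) fun s g => { s with var := f s.var g })) (stmtProg A N m q)
  | .pop k f q =>
    .seq (.op (.pop (.inl k) fun s g => { s with var := f s.var g })) (stmtProg A N m q)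
  | .load f q => .seq (.op (.load fun s => { s with var := f s.var })) (stmtProg A N m q)
  | .branch f q₁ q₂ =>
    .choose fun s => cond (f s.var) (stmtProg A N m q₁) (stmtProg A N m q₂)
  | .goto f => .op (.load fun s => { s with lab := some (f s.var) })
  | .halt => .op (.load fun s => { s with lab := none })

/-- The number of elementary statements in a statement. -/
def stmtSize : Turing.TM2.Stmt N.Γ N.Λ N.σ → ℕ
  | .push _ _ q => stmtSize q + 1
  | .peek _ _ q => stmtSize q + 1
  | .pop _ _ q => stmtSize q + 1
  | .load _ q => stmtSize q + 1
  | .branch _ q₁ q₂ => stmtSize q₁ + stmtSize q₂ + 1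
  | .goto _ => 1
  | .halt => 1

theorem noCoin_stmtProg (q : Turing.TM2.Stmt N.Γ N.Λ N.σ) : (stmtProg A N m q).NoCoin := by
  induction q with
  | branch f q₁ q₂ ih₁ ih₂ =>
    intro s
    show (cond (f s.var) (stmtProg A N m q₁) (stmtProg A N m q₂)).NoCoin
    cases f s.var
    · exact ih₂
    · exact ih₁
  | goto f => trivial
  | halt => trivial
  | _ => exact ⟨trivial, by assumption⟩

theorem exec_stmtProg (q : Turing.TM2.Stmt N.Γ N.Λ N.σ) (c : N.Cfg) :
    (stmtProg A N m q).Exec (simMem c cur vd a) (stmtSize q) []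
      (simMem (Turing.TM2.stepAux q c.var c.stk) cur vd a) := by
  induction q generalizing c with
  | push k f q ih =>
    refine .seq_nil (.op' ?_ le_rfl)
      (ih ⟨c.l, c.var, Function.update c.stk k (f c.var :: c.stk k)⟩) (by simp [stmtSize]; omega)
    exact congrArg (Prod.mk _) (update_joinStk_inl _ _ _ _)
  | peek k f q ih =>
    exact .seq_nil (.op' rfl le_rfl)
      (ih ⟨c.l, f c.var (c.stk k).head?, c.stk⟩) (by simp [stmtSize]; omega)
  | pop k f q ih =>
    refine .seq_nil (.op' ?_ le_rfl)
      (ih ⟨c.l, f c.var (c.stk k).head?, Function.update c.stk k (c.stk k).tail⟩)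
      (by simp [stmtSize]; omega)
    exact congrArg (Prod.mk _) (update_joinStk_inl _ _ _ _)
  | load f q ih =>
    exact .seq_nil (.op' rfl le_rfl) (ih ⟨c.l, f c.var, c.stk⟩) (by simp [stmtSize]; omega)
  | branch f q₁ q₂ ih₁ ih₂ =>
    refine .choose (t := stmtSize q₁ + stmtSize q₂) ?_ le_rfl
    show (cond (f c.var) (stmtProg A N m q₁) (stmtProg A N m q₂)).Exec _ _ _ _
    rw [Turing.TM2.stepAux]
    cases f c.var
    · exact (ih₂ c).mono (by omega)
    · exact (ih₁ c).mono (by omega)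
  | goto f => exact .op' rfl le_rfl
  | halt => exact .op' rfl le_rfl

/-- One step of the simulated machine; its nondeterministic moves are decided by the bits on an
auxiliary stack, and by `false` when there are none left. -/
def stepProg (A : Type) (N : NTM A') (m : ℕ) (l : N.Λ) : SimProg A N m :=
  match N.prog l with
  | .det q => stmtProg A N m q
  | .coin q =>
    .seq (popAux .bits) (.choose fun s => stmtProg A N m (q (AuxLetter.toBool s.cur)))

/-- The simulation of `N`. -/
def simulate (A : Type) (N : NTM A') (m : ℕ) : SimProg A N m :=
  .loop (fun s => s.lab.isSome) (.choose fun s => s.lab.elim skip (stepProg A N m))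

theorem noCoin_simulate : (simulate A N m).NoCoin := by
  intro s
  show (s.lab.elim skip (stepProg A N m)).NoCoin
  rcases s.lab with _ | l
  · trivial
  · show (stepProg A N m l).NoCoin
    unfold stepProg
    split
    · exact noCoin_stmtProg _
    · exact ⟨trivial, fun s => noCoin_stmtProg _⟩

/-- There are finitely many labels, so each simulated step costs at most a constant. The summand 4
pays for the loop test, the case distinction on the label, the pop of a bit and the case distinction
on that bit. -/
theorem exists_stepProg_bound (N : NTM A') : ∃ C : ℕ, ∀ l,
    match N.prog l with
    | .det q => stmtSize q + 4 ≤ C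
    | .coin q => ∀ b, stmtSize (q b) + 4 ≤ C := by
  obtain ⟨C, hC⟩ := (Set.finite_range fun l => match N.prog l with
    | .det q => stmtSize q + 4
    | .coin q => stmtSize (q true) + stmtSize (q false) + 4).bddAbove
  refine ⟨C, fun l => ?_⟩
  have := hC (Set.mem_range_self l)
  split <;> rename_i q h
  · simpa [h] using this
  · simp only [h] at this
    have h' : stmtSize (q true) + stmtSize (q false) + 4 ≤ C := this
    rintro (_ | _) <;> omega

/-- The simulation costs a constant factor. The bits that the run does not use stay on their stack,
where `balance` can find them. -/
theorem exists_exec_simulate (A : Type) (N : NTM A') (m : ℕ) : ∃ C : ℕ, ∀ {c c' : N.Cfg} {t : ℕ}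
    {w : List Bool}, N.Run c t w c' → c'.l = none → ∀ y : List Bool, Reads y w →
    ∀ (cur : Option (AuxLetter A)) (vd : Option Bool) (i tm wd : List (AuxLetter A))
      (r : ℕ → ℕ), ∃ cur', (simulate A N m).Exec
        (simMem c cur vd (auxStk i tm (y.map fun b => some (.inr b)) wd r)) (C * t + 1) []
        (simMem c' cur' vd (auxStk i tm ((y.drop w.length).map fun b => some (.inr b)) wd r)) := by
  obtain ⟨C, hC⟩ := exists_stepProg_bound N
  refine ⟨C, fun {c c' t w} h => ?_⟩
  induction h with
  | refl c =>
    intro hc y _ cur vd i tm wd r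
    exact ⟨cur, .loop_done (by simp [simMem, hc]) le_rfl⟩
  | @det c c' l q t w hl hq _ ih =>
    intro hc y hy cur vd i tm wd r
    obtain ⟨cur', h⟩ := ih hc y hy cur vd i tm wd r
    have hC := hC l
    rw [hq] at hC
    refine ⟨cur', .loop_step_nil (by simp [simMem, hl])
      (.choose (t := stmtSize q) ?_ le_rfl) h (by simp only at hC; rw [Nat.mul_succ]; omega)⟩
    simp only [simMem, hl, Option.elim, stepProg, hq]
    rw [← hl]
    exact exec_stmtProg q c
  | @coin c c' l q t w b hl hq _ ih =>
    intro hc y hy cur vd i tm wd r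
    obtain ⟨rfl, hy⟩ := hy
    obtain ⟨cur', h⟩ := ih hc y.tail hy (y.map fun b => some (.inr b)).head? vd i tm wd r
    have hC := hC l
    rw [hq] at hC
    rw [List.drop_tail, ← List.length_cons (a := y.headD false)] at h
    refine ⟨cur', .loop_step_nil (by simp [simMem, hl])
      (.choose (t := stmtSize (q (y.headD false)) + 2) ?_ le_rfl) h
      (by have := hC (y.headD false); rw [Nat.mul_succ]; omega)⟩
    simp only [simMem, hl, Option.elim, stepProg, hq]
    rw [← hl]
    refine .seq_nil (exec_popAux (c := c) .bits le_rfl) (.choose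
      (t := stmtSize (q (y.headD false))) ?_ le_rfl) (by omega)
    -- Popping from the empty stack is read as `false`, in agreement with `Reads`.
    have hb : AuxLetter.toBool (A := A) (y.map fun b => some (.inr b)).head? = y.headD false := by
      cases y <;> rfl
    rw [update_auxStk_bits]
    simp only [simMem, auxStk, hb, ← List.map_tail]
    exact exec_stmtProg _ c

/-- Empty the stack of bits, and decide by the bit `g` if one of them is `true`. -/
def decideBy (A : Type) (N : NTM A') (m : ℕ) (g : AuxLetter A) : SimProg A N m :=
  drain .bits fun g' => if AuxLetter.toBool (some g') then
    .op (.load fun s => { s with verdict := some (AuxLetter.toBool (some g)) }) else skip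

theorem exec_decideBy {i tm w : List (AuxLetter A)} {r : ℕ → ℕ} (b : Bool) (y : List Bool)
    (cur : Option (AuxLetter A)) (vd : Option Bool) :
    (decideBy A N m (some (.inr b))).Exec
      (simMem c cur vd (auxStk i tm (y.map fun b => some (.inr b)) w r)) (4 * y.length + 2) []
      (simMem c none (if true ∈ y then some b else vd) (auxStk i tm [] w r)) := by
  induction y generalizing cur vd with
  | nil => exact exec_drain_nil rfl (by omega)
  | cons b' y ih =>
    have h := ih (some (some (.inr b'))) (if b' = true then some b else vd)
    have e : (if true ∈ b' :: y then some b else vd) =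
        if true ∈ y then some b else if b' = true then some b else vd := by
      cases b' <;> simp
    rw [e]
    refine exec_drain_cons_nil (d := 1) rfl ?_ h (by simp; omega)
    rw [update_auxStk_bits]
    cases b'
    · exact .skip le_rfl
    · exact .op' rfl le_rfl

/-- Decide by the next unused bit if one of the further unused bits is `true`. -/
def balance (A : Type) (N : NTM A') (m : ℕ) : SimProg A N m :=
  .seq (popAux .bits) (.choose fun s => s.cur.elim skip (decideBy A N m))

/-- The decision that is made by `balance`. -/
def balanceVerdict : List Bool → Option Bool
  | [] => none
  | b :: y => if true ∈ y then some b else none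

theorem noCoin_balance : (balance A N m).NoCoin := by
  refine ⟨trivial, fun s => ?_⟩
  show (s.cur.elim skip (decideBy A N m)).NoCoin
  rcases s.cur with _ | g
  · trivial
  · refine noCoin_drain _ fun g' => ?_
    split_ifs <;> trivial

theorem exec_balance {i tm w : List (AuxLetter A)} {r : ℕ → ℕ}
    (cur : Option (AuxLetter A)) (y : List Bool) :
    (balance A N m).Exec
      (simMem c cur none (auxStk i tm (y.map fun b => some (.inr b)) w r)) (4 * y.length + 4) []
      (simMem c none (balanceVerdict y) (auxStk i tm [] w r)) := by
  have h := exec_popAux (c := c) (cur := cur) (vd := none)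
    (a := auxStk i tm (y.map fun b => some (.inr b)) w r) (.bits : AuxStack m) le_rfl
  rw [update_auxStk_bits] at h
  rcases y with _ | ⟨b, y⟩
  · exact .seq_nil h (.choose (t := 1) (.skip le_rfl) le_rfl) (by simp)
  · exact .seq_nil h (.choose (t := 4 * y.length + 2) (exec_decideBy b y _ none) le_rfl)
      (by simp; omega)

end NTM

/-! ### Time bounds of the form $g(k)\,p(n)$ -/

/-- The function is bounded by the product of a computable function of the parameter and a
polynomial of the length. -/
def FPTBound (F : ℕ → ℕ → ℕ) : Prop :=
  ∃ (g : ℕ → ℕ) (p : Polynomial ℕ), Computable g ∧ ∀ n k, F n k ≤ g k * p.eval n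

namespace FPTBound

variable {F G : ℕ → ℕ → ℕ}

theorem param {g : ℕ → ℕ} (hg : Computable g) : FPTBound fun _ k => g k :=
  ⟨g, 1, hg, by simp⟩

theorem const (c : ℕ) : FPTBound fun _ _ => c := param (.const c)

theorem poly (p : Polynomial ℕ) : FPTBound fun n _ => p.eval n :=
  ⟨fun _ => 1, p, .const 1, by simp⟩

theorem length : FPTBound fun n _ => n := by simpa using poly Polynomial.X

theorem add (hF : FPTBound F) (hG : FPTBound G) : FPTBound fun n k => F n k + G n k := by
  obtain ⟨g, p, hg, hF⟩ := hF
  obtain ⟨g', p', hg', hG⟩ := hG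
  refine ⟨fun k => g k + g' k, p + p', Primrec.nat_add.to_comp.comp hg hg', fun n k => ?_⟩
  have := hF n k
  have := hG n k
  rw [Polynomial.eval_add]
  nlinarith [Nat.zero_le (g k * p'.eval n), Nat.zero_le (g' k * p.eval n)]

theorem mul (hF : FPTBound F) (hG : FPTBound G) : FPTBound fun n k => F n k * G n k := by
  obtain ⟨g, p, hg, hF⟩ := hF
  obtain ⟨g', p', hg', hG⟩ := hG
  refine ⟨fun k => g k * g' k, p * p', Primrec.nat_mul.to_comp.comp hg hg', fun n k => ?_⟩
  rw [Polynomial.eval_mul, mul_mul_mul_comm]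
  exact Nat.mul_le_mul (hF n k) (hG n k)

end FPTBound

/-- A nonzero coefficient is at least 1, so $b^i\le p(b)$ for each monomial that occurs. It
separates parameter and length when a polynomial is evaluated at $(f(k)+1)\,n$, a bound for the
length of $\langle x,y\rangle$. -/
theorem Polynomial.eval_mul_le_nat (p : Polynomial ℕ) (a b : ℕ) :
    p.eval (a * b) ≤ p.eval a * p.eval b := by
  simp only [Polynomial.eval_eq_sum_range, Finset.sum_mul]
  refine Finset.sum_le_sum fun i hi => ?_
  rcases Nat.eq_zero_or_pos (p.coeff i) with h | h
  · simp [h]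
  · rw [mul_pow, ← mul_assoc]
    refine Nat.mul_le_mul_left _ (le_trans (Nat.le_mul_of_pos_left _ h) ?_)
    exact Finset.single_le_sum (f := fun j => p.coeff j * b ^ j) (fun _ _ => Nat.zero_le _) hi

theorem Polynomial.eval_mono_nat (p : Polynomial ℕ) {a b : ℕ} (h : a ≤ b) :
    p.eval a ≤ p.eval b := by
  simp only [Polynomial.eval_eq_sum_range]
  gcongr

theorem Polynomial.primrec_eval_nat (p : Polynomial ℕ) : Primrec fun n : ℕ => p.eval n := by
  induction p using Polynomial.induction_on with
  | C a => simpa using Primrec.const a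
  | add p q hp hq => simpa using Primrec.nat_add.comp hp hq
  | monomial n a h =>
    simp only [pow_succ, ← mul_assoc, Polynomial.eval_mul, Polynomial.eval_X] at h ⊢
    exact Primrec.nat_mul.comp h .id

/-! ### Path sets of machines with halting runs of equal length -/

namespace NTM

variable {A : Type}

theorem fptTime_of_bound {M : NTM A} {F : ℕ → ℕ → ℕ} (hF : FPTBound F)
    (h : ∀ x k t w c, M.Run (M.initCfg x k) t w c → t ≤ F x.length k) : M.FPTTime :=
  let ⟨g, p, hg, hp⟩ := hF
  ⟨g, p, hg, fun x k t w c r => (h x k t w c r).trans (hp _ _)⟩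

section paths

variable {M : NTM A} {x : List A} {k P B : ℕ}

/-- The choices of any partial computation, padded and cut to length `P`, are those of a known
halting run. The computation is compatible with that run, hence an initial segment of it, and
inherits its bounds. -/
theorem run_bounds_of_halting_runs
    (h : ∀ y : List Bool, y.length = P → ∃ t ≤ B, ∃ c, M.Run (M.initCfg x k) t y c ∧ c.l = none)
    {t : ℕ} {w : List Bool} {c : M.Cfg} (r : M.Run (M.initCfg x k) t w c) :
    t ≤ B ∧ w.length ≤ P := by
  obtain ⟨T, hT, d, r', hd⟩ := h ((w ++ List.replicate P false).take P) (by simp)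
  obtain ⟨T', u, rfl, hu, -⟩ := r.split_of_compatible r' hd ⟨_, _, List.take_append_drop _ _⟩
  have := congrArg List.length hu
  simp at this
  omega

theorem paths_eq_of_halting_runs {Q : List Bool → Prop}
    (h : ∀ y : List Bool, y.length = P → ∃ t c, M.Run (M.initCfg x k) t y c ∧ c.l = none ∧
      (c.var ∈ M.accept ↔ Q y)) :
    M.accPaths x k = {y | y.length = P ∧ Q y} ∧ M.rejPaths x k = {y | y.length = P ∧ ¬ Q y} := by
  have key : ∀ {t : ℕ} {w : List Bool} {c : M.Cfg}, M.Run (M.initCfg x k) t w c → c.l = none →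
      w.length = P ∧ (c.var ∈ M.accept ↔ Q w) := by
    intro t w c r hc
    have hl : ((w ++ List.replicate P false).take P).length = P := by simp
    obtain ⟨T, d, r', hd, hQ⟩ := h _ hl
    obtain ⟨hw, rfl⟩ := r.unique r' hc hd ⟨_, _, List.take_append_drop _ _⟩
    rw [hw] at hl hQ
    exact ⟨hl, hQ⟩
  constructor
  · ext y
    constructor
    · rintro ⟨t, c, r, hc, ha⟩
      exact ⟨(key r hc).1, (key r hc).2.1 ha⟩
    · rintro ⟨hl, hQ⟩
      obtain ⟨t, c, r, hc, ha⟩ := h y hl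
      exact ⟨t, c, r, hc, ha.2 hQ⟩
  · ext y
    constructor
    · rintro ⟨t, c, r, hc, ha⟩
      exact ⟨(key r hc).1, fun hQ => ha ((key r hc).2.2 hQ)⟩
    · rintro ⟨hl, hQ⟩
      obtain ⟨t, c, r, hc, ha⟩ := h y hl
      exact ⟨t, c, r, hc, fun h => hQ (ha.1 h)⟩

end paths

theorem Deterministic.run_eq_nil {M : NTM A} (hM : M.Deterministic) {c c' : M.Cfg} {t : ℕ}
    {w : List Bool} (h : M.Run c t w c') : w = [] := by
  induction h with
  | refl => rfl
  | det _ _ _ ih => exact ih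
  | @coin c c' l s _ _ _ _ hs =>
    obtain ⟨q, hq⟩ := hM l
    simp [hq] at hs

open StackProg

section machines

variable {A' : Type} {m : ℕ} (N : NTM A')

/-- The configuration of a machine with empty stacks. -/
def emptyCfg : N.Cfg := ⟨some N.main, N.start, fun _ => []⟩

theorem pushCfg_emptyCfg (x : List A') (k : ℕ) :
    pushCfg N.emptyCfg (inputString x k) = N.initCfg x k := by
  simp [pushCfg, emptyCfg, initCfg]

/-- The initial control state of a simulating machine. -/
def simStart (A : Type) : SimControl A N.Λ N.σ := ⟨some N.main, N.start, none, none⟩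

/-- The accepting control states of a simulating machine. -/
def simAccept (A : Type) : Set (SimControl A N.Λ N.σ) :=
  {s | s.verdict.elim (s.var ∈ N.accept) (· = true)}

theorem simMem_emptyCfg (l : List (AuxLetter A)) :
    (N.simStart A, Function.update (fun _ => [] : ∀ j, List (SimΓ A N m j)) (Sum.inr .inp) l) =
      simMem N.emptyCfg none none (auxStk l [] [] [] fun _ => 0) := by
  refine congrArg (Prod.mk _) ?_
  rw [← update_auxStk_inp (i := []), ← update_joinStk_inr]
  congr 1
  funext i
  rcases i with i | i
  · rfl
  · cases i <;> rfl

end machines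

/-! ### Replacing nondeterministic moves by an input string -/

section derandomize

theorem filterMap_unpairInput (z : List (A ⊕ Bool)) (k : ℕ) :
    (inputString z k).filterMap unpairInput = inputString (z.filterMap Sum.getLeft?) k := by
  rw [inputString, List.filterMap_append, inputString]
  congr 1
  · induction z with
    | nil => rfl
    | cons a z ih =>
      rcases a with a | b
      · rw [List.map_cons, List.filterMap_cons_some (f := unpairInput) rfl,
          List.filterMap_cons_some (f := Sum.getLeft?) rfl, ih,
          List.map_cons]
      · rw [List.map_cons, List.filterMap_cons_none rfl, List.filterMap_cons_none rfl, ih]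
  · induction k with
    | zero => rfl
    | succ k ih => simp_all [unpairInput, List.replicate_succ]

theorem filterMap_unpairBits (z : List (A ⊕ Bool)) (k : ℕ) :
    (inputString z k).filterMap unpairBits = z.filterMap Sum.getRight? := by
  rw [inputString, List.filterMap_append]
  have : (List.replicate k (none : Option (A ⊕ Bool))).filterMap unpairBits = [] := by
    induction k with
    | zero => rfl
    | succ k ih => simp_all [unpairBits, List.replicate_succ]
  rw [this, List.append_nil]
  induction z with
  | nil => rfl
  | cons a z ih =>
    rcases a with a | b
    · rw [List.map_cons, List.filterMap_cons_none rfl, List.filterMap_cons_none rfl, ih]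
    · rw [List.map_cons, List.filterMap_cons_some (f := unpairBits) rfl,
        List.filterMap_cons_some (f := Sum.getRight?) rfl, ih]

theorem filterMap_getLeft_pairString (x : List A) (y : List Bool) :
    (pairString x y).filterMap Sum.getLeft? = x := by
  rw [pairString, List.filterMap_append, List.filterMap_map, List.filterMap_map]
  have h₁ : (Sum.getLeft? ∘ (Sum.inl : A → A ⊕ Bool)) = some := rfl
  have h₂ : (Sum.getLeft? ∘ (Sum.inr : Bool → A ⊕ Bool)) = fun _ => none := rfl
  simp [h₁, h₂]

theorem filterMap_getRight_pairString (x : List A) (y : List Bool) :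
    (pairString x y).filterMap Sum.getRight? = y := by
  rw [pairString, List.filterMap_append, List.filterMap_map, List.filterMap_map]
  have h₁ : (Sum.getRight? ∘ (Sum.inl : A → A ⊕ Bool)) = fun _ => none := rfl
  have h₂ : (Sum.getRight? ∘ (Sum.inr : Bool → A ⊕ Bool)) = some := rfl
  simp [h₁, h₂]

variable [Finite A]

/-- The program of a deterministic machine that simulates `M` on `(x, k)`, given an instance
`(⟨x, y⟩, k)`, with `y` as the list of choices, and that finally runs the program `post`. -/
def derandomizeProg (M : NTM A) (post : SimProg A M 0) : SimProg A M 0 :=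
  .seq (drain .inp (pushAux .tmp)) (.seq (drain .tmp unpair) (.seq (simulate A M 0) post))

/-- The deterministic machine that runs `derandomizeProg`. -/
def derandomize (M : NTM A) (post : SimProg A M 0) : NTM (A ⊕ Bool) :=
  (derandomizeProg M post).toNTM (.inr .inp) (Function.Embedding.refl (AuxLetter A))
    (M.simStart A) (M.simAccept A)

theorem deterministic_derandomize (M : NTM A) {post : SimProg A M 0} (h : post.NoCoin) :
    (derandomize M post).Deterministic :=
  NoCoin.deterministic_toNTM (p := derandomizeProg M post) ⟨noCoin_drain _ fun _ => trivial,
    noCoin_drain _ noCoin_unpair, noCoin_simulate, h⟩ _ _ _ _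

/-- The input `z` is arbitrary and may mix letters and bits in any order: the time bound has to hold
on every input, not only on pairs. The function `V` describes how `post` may override the decision,
depending on the unused bits. -/
theorem exists_derandomize_run (M : NTM A) {post : SimProg A M 0}
    {V : List Bool → Option Bool} (hpost : ∀ (c : M.Cfg) (cur : Option (AuxLetter A))
      (y : List Bool), ∃ cur' a', post.Exec
        (simMem c cur none (auxStk [] [] (y.map fun b => some (.inr b)) [] fun _ => 0))
        (4 * y.length + 4) [] (simMem c cur' (V y) a')) :
    ∃ C : ℕ, ∀ (z : List (A ⊕ Bool)) (k : ℕ) {t : ℕ} {w : List Bool} {c : M.Cfg},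
      M.Run (M.initCfg (z.filterMap Sum.getLeft?) k) t w c → c.l = none →
      Reads (z.filterMap Sum.getRight?) w →
      ∃ t' ≤ 12 * z.length + 8 * k + C * t + 10, ∃ d : (derandomize M post).Cfg,
        (derandomize M post).Run ((derandomize M post).initCfg z k) t' [] d ∧ d.l = none ∧
        (d.var ∈ (derandomize M post).accept ↔
          (V ((z.filterMap Sum.getRight?).drop w.length)).elim (c.var ∈ M.accept) (· = true)) := by
  obtain ⟨C, hC⟩ := exists_exec_simulate A M 0
  refine ⟨C, fun z k {t w c} r hc hr => ?_⟩
  have h₁ := exec_transfer_inp (m := 0) (c := M.emptyCfg) (cur := none) (vd := none) (b := [])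
    (w := []) (r := fun _ => 0) (inputString z k)
  have h₂ := exec_unpair (m := 0) (vd := none) (w := []) (i := []) (r := fun _ => 0)
    (inputString z k).reverse none M.emptyCfg []
  rw [List.append_nil, ← List.filterMap_reverse, List.reverse_reverse,
    ← List.filterMap_reverse, List.reverse_reverse, filterMap_unpairInput, filterMap_unpairBits,
    pushCfg_emptyCfg] at h₂
  obtain ⟨cur₃, h₃⟩ := hC r hc _ hr none none [] [] [] fun _ => 0
  obtain ⟨cur₄, a', h₄⟩ := hpost c cur₃ ((z.filterMap Sum.getRight?).drop w.length)
  have hlen : (inputString z k).length = z.length + k := by simp [inputString]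
  have hlen' : ((z.filterMap Sum.getRight?).drop w.length).length ≤ z.length := by
    rw [List.length_drop]
    exact (Nat.sub_le _ _).trans (List.length_filterMap_le _ _)
  rw [hlen] at h₁
  rw [List.length_reverse, hlen] at h₂
  have h₅ := Exec.seq_nil h₃ h₄ le_rfl
  have h₆ := Exec.seq_nil h₂ h₅ le_rfl
  have h := Exec.seq_nil h₁ h₆ (T := 12 * z.length + 8 * k + C * t + 9) (by omega)
  rw [← simMem_emptyCfg, ← List.map_id (inputString z k)] at h
  obtain ⟨t', ht', r'⟩ := Exec.exists_toNTM_run (A := A ⊕ Bool) (p := derandomizeProg M post)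
    (k₀ := .inr .inp) (emb := Function.Embedding.refl (AuxLetter A)) (start := M.simStart A)
    (accept := M.simAccept A) (x := z) (k := k) h
  exact ⟨t', ht', _, r', rfl, Iff.rfl⟩

theorem fptTime_derandomize (M : NTM A) (hM : M.FPTTime) {post : SimProg A M 0}
    {V : List Bool → Option Bool} (hpost : ∀ (c : M.Cfg) (cur : Option (AuxLetter A))
      (y : List Bool), ∃ cur' a', post.Exec
        (simMem c cur none (auxStk [] [] (y.map fun b => some (.inr b)) [] fun _ => 0))
        (4 * y.length + 4) [] (simMem c cur' (V y) a')) :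
    (derandomize M post).FPTTime := by
  obtain ⟨C, hC⟩ := exists_derandomize_run M hpost
  obtain ⟨g, p, hg, hM⟩ := hM
  refine fptTime_of_bound (F := fun n k => 12 * n + 8 * k + C * (g k * p.eval n) + 10)
    (((((FPTBound.const 12).mul .length).add ((FPTBound.const 8).mul (.param .id))).add
      ((FPTBound.const C).mul ((FPTBound.param hg).mul (.poly p)))).add (.const 10)) ?_
  intro z k t w c r
  -- A halting run without choices is all that is needed: with `P = 0`, every computation is an
  -- initial segment of it.
  refine (run_bounds_of_halting_runs (P := 0) (fun y hy => ?_) r).1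
  obtain rfl := List.length_eq_zero_iff.1 hy
  obtain ⟨t, w, c, r, hc, hr⟩ := exists_halting_run_of_bounded _ _ (hM _ k)
    (z.filterMap Sum.getRight?)
  obtain ⟨t', ht', d, r', hd, -⟩ := hC z k r hc hr
  refine ⟨t', ht'.trans ?_, d, r', hd⟩
  have := (hM _ k t w c r).trans (Nat.mul_le_mul_left _
    (p.eval_mono_nat (List.length_filterMap_le Sum.getLeft? z)))
  gcongr

/-- Since `y` is at least as long as any list of choices, the padding by `false` is never used, and
exactly one halting path is a prefix of `y`. Its decision counts unless the unused bits override it.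
-/
theorem accPaths_derandomize_nonempty_iff (M : NTM A) (hM : M.FPTTime) {post : SimProg A M 0}
    {V : List Bool → Option Bool} (hpost : ∀ (c : M.Cfg) (cur : Option (AuxLetter A))
      (y : List Bool), ∃ cur' a', post.Exec
        (simMem c cur none (auxStk [] [] (y.map fun b => some (.inr b)) [] fun _ => 0))
        (4 * y.length + 4) [] (simMem c cur' (V y) a'))
    (x : List A) (y : List Bool) (k : ℕ)
    (hy : ∀ t w c, M.Run (M.initCfg x k) t w c → w.length ≤ y.length) :
    ((derandomize M post).accPaths (pairString x y) k).Nonempty ↔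
      ∃ w, w <+: y ∧ (w ∈ M.accPaths x k ∧ (V (y.drop w.length)).elim True (· = true) ∨
        w ∈ M.rejPaths x k ∧ (V (y.drop w.length)).elim False (· = true)) := by
  obtain ⟨C, hC⟩ := exists_derandomize_run M hpost
  obtain ⟨g, p, hg, hM⟩ := hM
  obtain ⟨t, w, c, r, hc, hr⟩ := exists_halting_run_of_bounded _ _ (hM x k) y
  obtain ⟨t', ht', d, r', hd, hacc⟩ := hC (pairString x y) k
    (by rwa [filterMap_getLeft_pairString]) hc (by rwa [filterMap_getRight_pairString])
  rw [filterMap_getRight_pairString] at hacc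
  have hw := hr.prefix (hy _ _ _ r)
  have key := (paths_eq_of_halting_runs (P := 0) (M := derandomize M post)
    (x := pairString x y) (k := k)
    (Q := fun _ => (V (y.drop w.length)).elim (c.var ∈ M.accept) (· = true)) fun y' hy' => by
      obtain rfl := List.length_eq_zero_iff.1 hy'
      exact ⟨t', d, r', hd, hacc⟩).1
  have huniq : ∀ {t' w' c'}, M.Run (M.initCfg x k) t' w' c' → c'.l = none → w' <+: y →
      w' = w ∧ c' = c := by
    intro t' w' c' r' hc' hw'
    obtain ⟨u, hu⟩ := hw
    obtain ⟨u', hu'⟩ := hw'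
    exact r.unique r' hc hc' ⟨u', u, hu'.trans hu.symm⟩
  rw [key]
  constructor
  · rintro ⟨_, -, hV⟩
    refine ⟨w, hw, ?_⟩
    by_cases ha : c.var ∈ M.accept
    · refine .inl ⟨⟨t, c, r, hc, ha⟩, ?_⟩
      rcases hv : V (y.drop w.length) with _ | b <;> rw [hv] at hV
      · trivial
      · exact hV
    · refine .inr ⟨⟨t, c, r, hc, ha⟩, ?_⟩
      rcases hv : V (y.drop w.length) with _ | b <;> rw [hv] at hV
      · exact ha hV
      · exact hV
  · rintro ⟨w', hw', ⟨⟨t', c', r', hc', ha⟩, hV⟩ | ⟨⟨t', c', r', hc', ha⟩, hV⟩⟩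
    · obtain ⟨rfl, rfl⟩ := huniq r' hc' hw'
      refine ⟨[], rfl, ?_⟩
      rcases hv : V (y.drop w'.length) with _ | b <;> rw [hv] at hV
      · exact ha
      · exact hV
    · obtain ⟨rfl, rfl⟩ := huniq r' hc' hw'
      refine ⟨[], rfl, ?_⟩
      rcases hv : V (y.drop w'.length) with _ | b <;> rw [hv] at hV
      · exact False.elim hV
      · exact hV

end derandomize

/-! ### Guessing a string and deciding an FPT language -/

section guess

variable [Finite A] {m : ℕ}

/-- The program of a machine that computes the length of a string of choices with the counter
program `p`, guesses such a string `y`, and then simulates `N` on `(⟨x, y⟩, k)`. -/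
def guessProg (N : NTM (A ⊕ Bool)) (hm : 6 ≤ m) (p : CounterProg) : SimProg A N m :=
  .seq (drain .inp (pushAux .tmp)) (.seq (drain .tmp (distribute N (by omega)))
    (.seq (counterProg N m p) (.seq (guess N ⟨5, by omega⟩) (.seq (drain .bits pushInput)
      (.seq (drain .word (pushAux .tmp)) (.seq (drain .tmp pushInput) (simulate A N m)))))))

/-- The machine that runs `guessProg`. -/
def guessMachine (N : NTM (A ⊕ Bool)) (hm : 6 ≤ m) (p : CounterProg) : NTM A :=
  (guessProg N hm p).toNTM (.inr .inp) (Function.Embedding.inl.optionMap : Option A ↪ AuxLetter A)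
    (N.simStart A) (N.simAccept A)

/-- The input stack of `N` is built from the bottom: first the parameter, then the guessed bits,
last the letters of `x`. Register 5 holds the number of bits to guess. -/
theorem exists_guessMachine_run (N : NTM (A ⊕ Bool)) (hm : 6 ≤ m)
    {p : CounterProg} (hp : p.width ≤ m) :
    ∃ C : ℕ, ∀ (x : List A) (k : ℕ) (y : List Bool) {t₀ t : ℕ} {s : ℕ → ℕ} {c : N.Cfg},
      p.Exec (twoRegs k x.length) t₀ s → s 5 = y.length →
      N.Run (N.initCfg (pairString x y) k) t [] c → c.l = none →
      ∃ t' ≤ 17 * x.length + 9 * k + 4 * t₀ + 9 * y.length + C * t + 14,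
        ∃ d : (guessMachine N hm p).Cfg,
        (guessMachine N hm p).Run ((guessMachine N hm p).initCfg x k) t' y d ∧ d.l = none ∧
        (d.var ∈ (guessMachine N hm p).accept ↔ c.var ∈ N.accept) := by
  obtain ⟨C, hC⟩ := exists_exec_simulate A N m
  refine ⟨C, fun x k y t₀ t s c h₀ hs r hc => ?_⟩
  -- The string as it is met after the first transfer.
  let l : List (A ⊕ Bool) := (x.map Sum.inl).reverse
  have hl : l.length = x.length := by simp [l]
  have hinp : (inputString x k).map (Function.Embedding.inl.optionMap : Option A ↪ AuxLetter A) =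
      (List.replicate k none ++ l.map some).reverse := by
    simp [inputString, l, Function.comp_def]
  have h₁ := exec_transfer_inp (m := m) (c := N.emptyCfg) (cur := none) (vd := none) (b := [])
    (w := []) (r := twoRegs 0 0) (List.replicate k none ++ l.map some).reverse
  rw [List.reverse_reverse] at h₁
  have h₂ := exec_distribute (m := m) (vd := none) (N := N) (by omega) (i := []) (b := []) k l none
    N.emptyCfg 0
  rw [Nat.zero_add, hl] at h₂
  obtain ⟨cur₃, h₃⟩ := exec_counterProg (c := pushCfg N.emptyCfg (List.replicate k none))
    (N := N) (vd := none) (i := []) (tm := []) (b := []) (w := (l.map some).reverse) h₀ hp none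
  have h₄ := exec_guess (m := m) (c := pushCfg N.emptyCfg (List.replicate k none))
    (N := N) (vd := none) (i := []) (tm := []) (w := (l.map some).reverse) ⟨5, by omega⟩ y s
    cur₃ [] hs
  rw [List.append_nil] at h₄
  have h₅ := exec_drain_pushInput (vd := none) (j := .bits)
    (y.reverse.map fun b => some (.inr b)) none (pushCfg N.emptyCfg (List.replicate k none))
    (auxStk (m := m) [] [] (y.reverse.map fun b => some (.inr b)) (l.map some).reverse
      (Function.update s 5 0)) rfl
  rw [update_auxStk_bits] at h₅
  have h₆ := exec_transfer_word (m := m) (c := pushCfg (pushCfg N.emptyCfg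
    (List.replicate k none)) (y.reverse.map fun b => some (.inr b)).reverse) (cur := none)
    (vd := none) (i := []) (b := []) (r := Function.update s 5 0) (l.map some).reverse
  have h₇ := exec_drain_pushInput (vd := none) (j := .tmp) (l.map some).reverse.reverse none
    (pushCfg (pushCfg N.emptyCfg (List.replicate k none))
      (y.reverse.map fun b => some (.inr b)).reverse)
    (auxStk (m := m) [] (l.map some).reverse.reverse [] [] (Function.update s 5 0)) rfl
  have hfin : pushCfg (pushCfg (pushCfg N.emptyCfg (List.replicate k none))
      (y.reverse.map fun b => some (.inr b)).reverse) (l.map some).reverse.reverse.reverse =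
      N.initCfg (pairString x y) k := by
    rw [pushCfg_pushCfg, pushCfg_pushCfg, ← pushCfg_emptyCfg]
    congr 1
    simp [l, inputString, pairString, Function.comp_def]
  rw [update_auxStk_tmp, hfin] at h₇
  obtain ⟨cur₈, h₈⟩ := hC r hc [] (reads_nil _) none none [] [] [] (Function.update s 5 0)
  have e₇ := Exec.seq_nil h₇ h₈ le_rfl
  have e₆ := Exec.seq_nil h₆ e₇ le_rfl
  have e₅ := Exec.seq_nil h₅ e₆ le_rfl
  have e₄ := Exec.seq h₄ e₅ le_rfl
  have e₃ := Exec.seq h₃ e₄ le_rfl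
  have e₂ := Exec.seq h₂ e₃ le_rfl
  have e₁ := (Exec.seq h₁ e₂ le_rfl).mono
    (T := 17 * x.length + 9 * k + 4 * t₀ + 9 * y.length + C * t + 13) (by
      simp only [List.length_reverse, List.length_append, List.length_replicate, List.length_map,
        hl]
      omega)
  have hz : twoRegs 0 0 = fun _ => 0 := by simp [twoRegs]
  rw [List.nil_append, List.nil_append, List.nil_append, List.append_nil, hz, ← simMem_emptyCfg,
    ← hinp] at e₁
  obtain ⟨t', ht', r'⟩ := Exec.exists_toNTM_run (A := A) (p := guessProg N hm p)
    (k₀ := .inr .inp) (start := N.simStart A) (accept := N.simAccept A) (x := x) (k := k) e₁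
  exact ⟨t', ht', _, r', rfl, Iff.rfl⟩

/-- Each string of the right length is the list of choices of exactly one halting run, on which the
deterministic machine for `B` decides. All paths thus have equal length, and no other paths exist.
-/
theorem exists_guess_machine {B : ParamLanguage (A ⊕ Bool)} (hB : InFPT B) {f : ℕ → ℕ}
    (hf : Computable f) : ∃ M : NTM A, M.KRestricted ∧ ∀ (x : List A) (k : ℕ),
      M.accPaths x k =
        {y | y.length = f k * Nat.log 2 x.length ∧ (pairString x y, k) ∈ B} ∧
      M.rejPaths x k =
        {y | y.length = f k * Nat.log 2 x.length ∧ (pairString x y, k) ∉ B} := by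
  obtain ⟨N, hN, ⟨g, q, hg, hq⟩, hB⟩ := hB
  obtain ⟨T, p, hT, hp⟩ := CounterProg.exists_exec_mul_log hf
  have hm : 6 ≤ max 6 p.width := le_max_left _ _
  obtain ⟨C, hC⟩ := exists_guessMachine_run N hm (p := p) (le_max_right _ _)
  have key : ∀ (x : List A) (k : ℕ) (y : List Bool), y.length = f k * Nat.log 2 x.length →
      ∃ t ≤ 17 * x.length + 9 * k + 4 * (T k + (22 * x.length + 2) +
          (f k * (7 * x.length + 4) + 1)) + 9 * (f k * x.length) +
          C * (g k * (q.eval (f k + 1) * q.eval x.length)) + 14,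
        ∃ c, (guessMachine N hm p).Run ((guessMachine N hm p).initCfg x k) t y c ∧ c.l = none ∧
          (c.var ∈ (guessMachine N hm p).accept ↔ (pairString x y, k) ∈ B) := by
    intro x k y hy
    obtain ⟨s, hs, hs5⟩ := hp k x.length
    obtain ⟨t, w, c, r, hc, -⟩ := exists_halting_run_of_bounded _ _ (hq (pairString x y) k) []
    obtain rfl := hN.run_eq_nil r
    obtain ⟨t', ht', d, r', hd, ha⟩ := hC x k y hs (hs5.trans hy.symm) r hc
    have hlog : Nat.log 2 x.length ≤ x.length := Nat.log_le_self _ _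
    refine ⟨t', ht'.trans ?_, d, r', hd, ha.trans ?_⟩
    · have h₁ : (pairString x y).length ≤ (f k + 1) * x.length := by
        have := Nat.mul_le_mul_left (f k) hlog
        simp only [pairString, List.length_append, List.length_map, hy]
        nlinarith
      have h₂ := (hq _ _ _ _ _ r).trans (Nat.mul_le_mul_left (g k)
        ((q.eval_mono_nat h₁).trans (q.eval_mul_le_nat _ _)))
      rw [hy]
      gcongr
    · rw [hB]
      constructor
      · exact fun h => ⟨[], t, c, r, hc, h⟩
      · rintro ⟨w, t', c', r', hc', h⟩
        obtain rfl := hN.run_eq_nil r'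
        obtain ⟨-, rfl⟩ := r.unique r' hc hc' ⟨[], [], rfl⟩
        exact h
  refine ⟨guessMachine N hm p, ⟨fptTime_of_bound (F := fun n k => 17 * n + 9 * k +
    4 * (T k + (22 * n + 2) + (f k * (7 * n + 4) + 1)) + 9 * (f k * n) +
    C * (g k * (q.eval (f k + 1) * q.eval n)) + 14) ?_ fun x k t w c r => ?_,
    f, hf, fun x k t w c r => ?_⟩, fun x k => paths_eq_of_halting_runs fun y hy => ?_⟩
  · have hq' : Computable fun k => q.eval (f k + 1) :=
      q.primrec_eval_nat.to_comp.comp (Primrec.succ.to_comp.comp hf)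
    have hk := FPTBound.param .id
    have hf' := FPTBound.param hf
    have hn := FPTBound.length
    have hc := FPTBound.const
    exact ((((((hc 17).mul hn).add ((hc 9).mul hk)).add ((hc 4).mul (((FPTBound.param hT).add
      (((hc 22).mul hn).add (hc 2))).add ((hf'.mul (((hc 7).mul hn).add (hc 4))).add (hc 1))))).add
      ((hc 9).mul (hf'.mul hn))).add ((hc C).mul ((FPTBound.param hg).mul
        ((FPTBound.param hq').mul (.poly q))))).add (hc 14)
  · exact (run_bounds_of_halting_runs (fun y hy => let ⟨t, ht, c, r, hc, _⟩ := key x k y hy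
      ⟨t, ht, c, r, hc⟩) r).1
  · exact (run_bounds_of_halting_runs (fun y hy => let ⟨t, ht, c, r, hc, _⟩ := key x k y hy
      ⟨t, ht, c, r, hc⟩) r).2
  · obtain ⟨t, -, c, r, hc, h⟩ := key x k y hy
    exact ⟨t, c, r, hc, h⟩

end guess

end NTM

/-! ### Counting extensions of paths -/

section counting

theorem List.ncard_length_eq_bool (n : ℕ) : {z : List Bool | z.length = n}.ncard = 2 ^ n := by
  rw [← Nat.card_coe_set_eq]
  have : Nat.card (List.Vector Bool n) = 2 ^ n := by simp
  exact this

theorem List.finite_length_and (n : ℕ) (p : List Bool → Prop) :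
    {z : List Bool | z.length = n ∧ p z}.Finite :=
  (List.finite_length_eq Bool n).subset fun _ h => h.1

/-- The strings of length `P` that extend one of several strings, none of which is a prefix of
another one, with a condition on the remaining part. -/
theorem ncard_prefix_extensions (W : Finset (List Bool)) {P : ℕ}
    (hpf : ∀ w ∈ W, ∀ w' ∈ W, ∀ y, w <+: y → w' <+: y → w = w')
    (hW : ∀ w ∈ W, w.length ≤ P) (R : List Bool → List Bool → Prop) :
    {y : List Bool | y.length = P ∧ ∃ w ∈ W, w <+: y ∧ R w (y.drop w.length)}.ncard =
      ∑ w ∈ W, {z : List Bool | z.length = P - w.length ∧ R w z}.ncard := by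
  induction W using Finset.induction_on with
  | empty => simp
  | insert w W hw ih =>
    rw [Finset.sum_insert hw, ← ih (fun v hv v' hv' => hpf v (Finset.mem_insert_of_mem hv) v'
      (Finset.mem_insert_of_mem hv')) fun v hv => hW v (Finset.mem_insert_of_mem hv),
      ← Set.ncard_image_of_injective {z : List Bool | z.length = P - w.length ∧ R w z}
        (List.append_right_injective w), ← Set.ncard_union_eq ?_
      ((List.finite_length_and _ _).image _) (List.finite_length_and _ _)]
    · congr 1
      ext y
      have hwP := hW w (Finset.mem_insert_self _ _)
      simp only [Set.mem_ofPred_eq, Finset.exists_mem_insert, Set.mem_union, Set.mem_image]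
      constructor
      · rintro ⟨hy, ⟨⟨z, rfl⟩, hR⟩ | h⟩
        · rw [List.drop_left] at hR
          exact .inl ⟨z, ⟨by simp at hy; omega, hR⟩, rfl⟩
        · exact .inr ⟨hy, h⟩
      · rintro (⟨z, ⟨hz, hR⟩, rfl⟩ | ⟨hy, h⟩)
        · exact ⟨by simp; omega, .inl ⟨⟨z, rfl⟩, by rwa [List.drop_left]⟩⟩
        · exact ⟨hy, .inr h⟩
    · rw [Set.disjoint_left]
      rintro _ ⟨z, -, rfl⟩ ⟨-, v, hv, hvp, -⟩
      exact hw (hpf w (Finset.mem_insert_self _ _) v (Finset.mem_insert_of_mem hv) _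
        ⟨z, rfl⟩ hvp ▸ hv)

/-- The good strings are those beginning with `true`, and in addition the string of `false` only,
for which the accepting decision is not overridden. -/
theorem ncard_balance_true {r : ℕ} (hr : r ≠ 0) :
    2 * {z : List Bool | z.length = r ∧ (NTM.balanceVerdict z).elim True (· = true)}.ncard =
      2 ^ r + 2 := by
  obtain ⟨r, rfl⟩ := Nat.exists_eq_succ_of_ne_zero hr
  have : {z : List Bool | z.length = r + 1 ∧ (NTM.balanceVerdict z).elim True (· = true)} =
      insert (false :: List.replicate r false) (List.cons true '' {z | z.length = r}) := by
    ext z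
    rcases z with _ | ⟨b, z⟩
    · simp
    · by_cases hz : true ∈ z
      · have : z ≠ List.replicate r false := by
          rintro rfl
          simp at hz
        cases b <;> simp [NTM.balanceVerdict, hz, this]
      · have hz' : z = List.replicate z.length false :=
          List.eq_replicate_of_mem fun b hb => by cases b <;> simp_all
        cases b
        · simp only [NTM.balanceVerdict, hz, if_false, Set.mem_ofPred_eq, Set.mem_insert_iff]
          simp only [List.length_cons, Option.elim, and_true, List.cons.injEq, true_and,
            Set.mem_image, Set.mem_ofPred_eq, Bool.true_eq_false, false_and, and_false, exists_false,
            or_false, Nat.add_right_cancel_iff]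
          exact ⟨fun h => h ▸ hz', fun h => by rw [h, List.length_replicate]⟩
        · simp [NTM.balanceVerdict, hz]
  rw [Nat.succ_eq_add_one, this, Set.ncard_insert_of_notMem (by simp)
    ((List.finite_length_eq Bool r).image _),
    Set.ncard_image_of_injective _ (List.cons_injective), List.ncard_length_eq_bool, pow_succ]
  ring

/-- The good strings begin with `true`, except for the one whose other bits are all `false`, where
the rejecting decision stands. -/
theorem ncard_balance_false {r : ℕ} (hr : r ≠ 0) :
    2 * {z : List Bool | z.length = r ∧ (NTM.balanceVerdict z).elim False (· = true)}.ncard + 2 =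
      2 ^ r := by
  obtain ⟨r, rfl⟩ := Nat.exists_eq_succ_of_ne_zero hr
  have : {z : List Bool | z.length = r + 1 ∧ (NTM.balanceVerdict z).elim False (· = true)} =
      List.cons true '' ({z | z.length = r} \ {List.replicate r false}) := by
    ext z
    rcases z with _ | ⟨b, z⟩
    · simp
    · by_cases hz : true ∈ z
      · have : z ≠ List.replicate r false := by
          rintro rfl
          simp at hz
        cases b <;> simp [NTM.balanceVerdict, hz, this]
      · have hz' : z = List.replicate z.length false :=
          List.eq_replicate_of_mem fun b hb => by cases b <;> simp_all
        simp only [NTM.balanceVerdict, hz, if_false, Set.mem_ofPred_eq, Option.elim, and_false,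
          Set.mem_image, Set.mem_sdiff, Set.mem_singleton_iff, List.cons.injEq, false_iff,
          not_exists, not_and]
        rintro z ⟨rfl, h⟩ - rfl
        exact h hz'
  have h := Set.ncard_sdiff_singleton_add_one (s := {z : List Bool | z.length = r})
    (a := List.replicate r false) (by simp) (List.finite_length_eq Bool r)
  rw [List.ncard_length_eq_bool] at h
  rw [Nat.succ_eq_add_one, this, Set.ncard_image_of_injective _ (List.cons_injective), pow_succ,
    ← h]
  ring

end counting

/-! ### Acceptance probability and gap as counts of strings -/

namespace NTM

variable {A : Type} {M : NTM A} {x : List A} {k P : ℕ}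

theorem mem_unique_of_prefix {w w' y : List Bool}
    (hw : w ∈ M.accPaths x k ∪ M.rejPaths x k) (hw' : w' ∈ M.accPaths x k ∪ M.rejPaths x k)
    (h : w <+: y) (h' : w' <+: y) : w = w' := by
  obtain ⟨u, hu⟩ := h
  obtain ⟨u', hu'⟩ := h'
  have : ∀ w ∈ M.accPaths x k ∪ M.rejPaths x k,
      ∃ t c, M.Run (M.initCfg x k) t w c ∧ c.l = none := by
    rintro w (⟨t, c, r, hc, -⟩ | ⟨t, c, r, hc, -⟩) <;> exact ⟨t, c, r, hc⟩
  obtain ⟨t, c, r, hc⟩ := this w hw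
  obtain ⟨t', c', r', hc'⟩ := this w' hw'
  exact (r'.unique r hc' hc ⟨u, u', hu.trans hu'.symm⟩).1

theorem disjoint_accPaths_rejPaths : Disjoint (M.accPaths x k) (M.rejPaths x k) := by
  rw [Set.disjoint_left]
  rintro w ⟨t, c, r, hc, h⟩ ⟨t', c', r', hc', h'⟩
  obtain ⟨-, rfl⟩ := r.unique r' hc hc' ⟨[], [], rfl⟩
  exact h' h

theorem length_le_of_mem_paths (hP : ∀ t w c, M.Run (M.initCfg x k) t w c → w.length ≤ P)
    {w : List Bool} (hw : w ∈ M.accPaths x k ∪ M.rejPaths x k) : w.length ≤ P := by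
  rcases hw with ⟨t, c, r, -, -⟩ | ⟨t, c, r, -, -⟩ <;> exact hP _ _ _ r

theorem finite_paths (hP : ∀ t w c, M.Run (M.initCfg x k) t w c → w.length ≤ P) :
    (M.accPaths x k ∪ M.rejPaths x k).Finite :=
  (List.finite_length_le Bool P).subset fun _ hw => length_le_of_mem_paths hP hw

theorem half_lt_probAcc_iff {W : Finset (List Bool)} (hW : M.accPaths x k = W)
    (hP : ∀ w ∈ W, w.length ≤ P) :
    1 / 2 < M.probAcc x k ↔ 2 ^ P < 2 * ∑ w ∈ W, 2 ^ (P - w.length) := by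
  have h₁ : M.probAcc x k * 2 ^ P = ((∑ w ∈ W, 2 ^ (P - w.length) : ℕ) : ℝ≥0∞) := by
    have : M.probAcc x k = ∑ w ∈ W, (2⁻¹ : ℝ≥0∞) ^ w.length := by
      rw [probAcc, hW]
      exact Finset.tsum_subtype W fun w => (2⁻¹ : ℝ≥0∞) ^ w.length
    rw [this, Finset.sum_mul, Nat.cast_sum]
    refine Finset.sum_congr rfl fun w hw => ?_
    rw [← Nat.add_sub_of_le (hP w hw), pow_add, ← mul_assoc, ← mul_pow,
      ENNReal.inv_mul_cancel (by norm_num) (by norm_num), one_pow, one_mul, Nat.add_sub_cancel_left]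
    push_cast
    rfl
  -- Multiplying by this finite positive number clears all denominators.
  have h₂ : (2 * 2 ^ P : ℝ≥0∞) ≠ 0 := by positivity
  have h₃ : (2 * 2 ^ P : ℝ≥0∞) ≠ ⊤ := by finiteness
  rw [← ENNReal.mul_lt_mul_iff_left h₂ h₃, mul_left_comm (M.probAcc x k), h₁, one_div, ← mul_assoc,
    ENNReal.inv_mul_cancel (by norm_num) (by norm_num), one_mul]
  norm_cast

/-- The halting paths form a complete prefix code. -/
theorem sum_two_pow_paths {W : Finset (List Bool)} (hW : M.accPaths x k ∪ M.rejPaths x k = W)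
    (hM : M.FPTTime) (hP : ∀ t w c, M.Run (M.initCfg x k) t w c → w.length ≤ P) :
    ∑ w ∈ W, 2 ^ (P - w.length) = 2 ^ P := by
  have hmem : ∀ w, w ∈ W ↔ w ∈ M.accPaths x k ∪ M.rejPaths x k := fun w => by
    rw [hW, Finset.mem_coe]
  have h := ncard_prefix_extensions W (P := P)
    (fun w hw w' hw' y => mem_unique_of_prefix ((hmem w).1 hw) ((hmem w').1 hw'))
    (fun w hw => length_le_of_mem_paths hP ((hmem w).1 hw)) fun _ _ => True
  simp only [and_true, List.ncard_length_eq_bool] at h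
  rw [← h, ← List.ncard_length_eq_bool P]
  congr 1
  ext y
  simp only [Set.mem_ofPred_eq]
  refine and_iff_left_of_imp fun hy => ?_
  obtain ⟨g, p, -, hM⟩ := hM
  obtain ⟨t, w, c, r, hc, hr⟩ := exists_halting_run_of_bounded _ _ (hM x k) y
  refine ⟨w, (hmem w).2 ?_, hr.prefix (hy ▸ hP _ _ _ r)⟩
  by_cases ha : c.var ∈ M.accept
  · exact .inl ⟨t, c, r, hc, ha⟩
  · exact .inr ⟨t, c, r, hc, ha⟩

/-- No decision is overridden here: all $2^{P-m}$ extensions of an accepting path with $m$ choices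
are good, which is $2^P$ times its probability. -/
theorem exists_fpt_majority_of_probAcc [Finite A] (hM : M.KRestricted) :
    ∃ (B : ParamLanguage (A ⊕ Bool)) (f : ℕ → ℕ), InFPT B ∧ Computable f ∧
      ∀ (x : List A) (k : ℕ), 1 / 2 < M.probAcc x k ↔
        2 * {y : List Bool | y.length = f k * Nat.log 2 x.length ∧
          (pairString x y, k) ∈ B}.ncard > 2 ^ (f k * Nat.log 2 x.length) := by
  obtain ⟨hT, f, hf, hP⟩ := hM
  have hpost : ∀ (c : M.Cfg) (cur : Option (AuxLetter A)) (y : List Bool), ∃ cur' a',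
      (StackProg.skip : SimProg A M 0).Exec
        (simMem c cur none (auxStk [] [] (y.map fun b => some (.inr b)) [] fun _ => 0))
        (4 * y.length + 4) [] (simMem c cur' ((fun _ => none : List Bool → Option Bool) y) a') :=
    fun c cur y => ⟨_, _, .skip (by omega)⟩
  refine ⟨{z | ((derandomize M StackProg.skip).accPaths z.1 z.2).Nonempty}, f,
    ⟨_, deterministic_derandomize M (post := StackProg.skip) trivial, fptTime_derandomize M hT hpost, fun x k => Iff.rfl⟩,
    hf, fun x k => ?_⟩
  have hfin := (finite_paths (hP x k)).subset Set.subset_union_left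
  have hW : M.accPaths x k = hfin.toFinset := hfin.coe_toFinset.symm
  have hmem : ∀ w, w ∈ hfin.toFinset ↔ w ∈ M.accPaths x k := fun w => hfin.mem_toFinset
  have hle : ∀ w ∈ hfin.toFinset, w.length ≤ f k * Nat.log 2 x.length :=
    fun w hw => length_le_of_mem_paths (hP x k) (.inl ((hmem w).1 hw))
  have h := ncard_prefix_extensions hfin.toFinset
    (fun w hw w' hw' y => mem_unique_of_prefix (.inl ((hmem w).1 hw)) (.inl ((hmem w').1 hw')))
    hle fun _ _ => True
  simp only [and_true, List.ncard_length_eq_bool] at h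
  rw [half_lt_probAcc_iff hW hle, ← h, gt_iff_lt]
  have : {y : List Bool | y.length = f k * Nat.log 2 x.length ∧
        ∃ w ∈ hfin.toFinset, w <+: y} =
      {y : List Bool | y.length = f k * Nat.log 2 x.length ∧
        ((derandomize M StackProg.skip).accPaths (pairString x y) k).Nonempty} := by
    ext y
    refine and_congr_right fun hy => ?_
    rw [accPaths_derandomize_nonempty_iff M hT hpost x y k (hy ▸ hP x k)]
    refine exists_congr fun w => ?_
    simp [hmem, and_comm]
  rw [this]
  rfl

theorem exists_fpt_majority_of_gap [Finite A] (hM : M.KRestricted) :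
    ∃ (B : ParamLanguage (A ⊕ Bool)) (f : ℕ → ℕ), InFPT B ∧ Computable f ∧
      ∀ (x : List A) (k : ℕ), (M.numAcc x k : ℤ) - (M.numRej x k : ℤ) > 0 ↔
        2 * {y : List Bool | y.length = f k * Nat.log 2 x.length ∧
          (pairString x y, k) ∈ B}.ncard > 2 ^ (f k * Nat.log 2 x.length) := by
  obtain ⟨hT, f, hf, hP⟩ := hM
  have hpost : ∀ (c : M.Cfg) (cur : Option (AuxLetter A)) (y : List Bool), ∃ cur' a',
      (balance A M 0).Exec
        (simMem c cur none (auxStk [] [] (y.map fun b => some (.inr b)) [] fun _ => 0))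
        (4 * y.length + 4) [] (simMem c cur' (balanceVerdict y) a') :=
    fun c cur y => ⟨_, _, exec_balance cur y⟩
  -- The summand 1 provides $\log n$ additional bits, so that every path leaves a bit unused as soon
  -- as $\log n>0$.
  refine ⟨{z | ((derandomize M (balance A M 0)).accPaths z.1 z.2).Nonempty}, fun k => f k + 1,
    ⟨_, deterministic_derandomize M noCoin_balance, fptTime_derandomize M hT hpost,
      fun x k => Iff.rfl⟩, Primrec.succ.to_comp.comp hf, fun x k => ?_⟩
  set P := (f k + 1) * Nat.log 2 x.length with hPdef
  have hPx : ∀ t w c, M.Run (M.initCfg x k) t w c → w.length ≤ P := fun t w c r =>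
    (hP x k t w c r).trans (Nat.mul_le_mul_right _ (Nat.le_succ _))
  have hfa := (finite_paths hPx).subset Set.subset_union_left
  have hfr := (finite_paths hPx).subset Set.subset_union_right
  have ha : ∀ w, w ∈ hfa.toFinset ↔ w ∈ M.accPaths x k := fun w => hfa.mem_toFinset
  have hr : ∀ w, w ∈ hfr.toFinset ↔ w ∈ M.rejPaths x k := fun w => hfr.mem_toFinset
  have hdisj : Disjoint hfa.toFinset hfr.toFinset := by
    rw [← Finset.disjoint_coe, hfa.coe_toFinset, hfr.coe_toFinset]
    exact disjoint_accPaths_rejPaths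
  have hW : M.accPaths x k ∪ M.rejPaths x k = ((hfa.toFinset ∪ hfr.toFinset : Finset _) : Set _) := by
    rw [Finset.coe_union, hfa.coe_toFinset, hfr.coe_toFinset]
  have hmem : ∀ w, w ∈ hfa.toFinset ∪ hfr.toFinset ↔ w ∈ M.accPaths x k ∪ M.rejPaths x k :=
    fun w => by rw [hW, Finset.mem_coe]
  have hsum := sum_two_pow_paths hW hT hPx
  rw [Finset.sum_union hdisj] at hsum
  have hcount := ncard_prefix_extensions (hfa.toFinset ∪ hfr.toFinset) (P := P)
    (fun w hw w' hw' y => mem_unique_of_prefix ((hmem w).1 hw) ((hmem w').1 hw'))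
    (fun w hw => length_le_of_mem_paths hPx ((hmem w).1 hw))
    fun w z => w ∈ M.accPaths x k ∧ (balanceVerdict z).elim True (· = true) ∨
      w ∈ M.rejPaths x k ∧ (balanceVerdict z).elim False (· = true)
  have hset : {y : List Bool | y.length = P ∧ ∃ w ∈ hfa.toFinset ∪ hfr.toFinset, w <+: y ∧
        (w ∈ M.accPaths x k ∧ (balanceVerdict (y.drop w.length)).elim True (· = true) ∨
          w ∈ M.rejPaths x k ∧ (balanceVerdict (y.drop w.length)).elim False (· = true))} =
      {y : List Bool | y.length = P ∧
        ((derandomize M (balance A M 0)).accPaths (pairString x y) k).Nonempty} := by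
    ext y
    refine and_congr_right fun hy => ?_
    rw [accPaths_derandomize_nonempty_iff M hT hpost x y k (hy ▸ hPx)]
    refine exists_congr fun w => ⟨fun h => h.2, fun h => ⟨(hmem w).2 ?_, h⟩⟩
    exact h.2.imp And.left And.left
  rw [hset, Finset.sum_union hdisj] at hcount
  have hA : ∀ w ∈ hfa.toFinset, {z : List Bool | z.length = P - w.length ∧
      (w ∈ M.accPaths x k ∧ (balanceVerdict z).elim True (· = true) ∨
        w ∈ M.rejPaths x k ∧ (balanceVerdict z).elim False (· = true))} =
      {z : List Bool | z.length = P - w.length ∧ (balanceVerdict z).elim True (· = true)} := by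
    intro w hw
    have h₁ := (ha w).1 hw
    have h₂ : w ∉ M.rejPaths x k := Set.disjoint_left.1 disjoint_accPaths_rejPaths h₁
    simp only [h₁, h₂, true_and, false_and, or_false]
  have hR : ∀ w ∈ hfr.toFinset, {z : List Bool | z.length = P - w.length ∧
      (w ∈ M.accPaths x k ∧ (balanceVerdict z).elim True (· = true) ∨
        w ∈ M.rejPaths x k ∧ (balanceVerdict z).elim False (· = true))} =
      {z : List Bool | z.length = P - w.length ∧ (balanceVerdict z).elim False (· = true)} := by
    intro w hw
    have h₁ := (hr w).1 hw
    have h₂ : w ∉ M.accPaths x k := Set.disjoint_right.1 disjoint_accPaths_rejPaths h₁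
    simp only [h₁, h₂, true_and, false_and, false_or]
  rw [Finset.sum_congr rfl fun w hw => congrArg Set.ncard (hA w hw),
    Finset.sum_congr rfl fun w hw => congrArg Set.ncard (hR w hw)] at hcount
  have hna : M.numAcc x k = hfa.toFinset.card := Set.ncard_eq_toFinset_card _ hfa
  have hnr : M.numRej x k = hfr.toFinset.card := Set.ncard_eq_toFinset_card _ hfr
  rw [hna, hnr]
  show _ ↔ 2 * {y : List Bool | y.length = P ∧
    ((derandomize M (balance A M 0)).accPaths (pairString x y) k).Nonempty}.ncard > 2 ^ P
  rw [hcount]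
  -- If $\log n=0$ there are no bits at all. The completeness of the prefix code then says that
  -- there is exactly one halting path, and both sides say that it accepts.
  rcases Nat.eq_zero_or_pos (Nat.log 2 x.length) with hlog | hlog
  · have hP0 : P = 0 := by rw [hPdef, hlog, Nat.mul_zero]
    have e₁ : {z : List Bool | z.length = 0 ∧ (balanceVerdict z).elim True (· = true)} = {[]} := by
      ext z
      cases z <;> simp [balanceVerdict]
    have e₂ : {z : List Bool | z.length = 0 ∧ (balanceVerdict z).elim False (· = true)} = ∅ := by
      ext z
      cases z <;> simp [balanceVerdict]
    simp only [hP0, Nat.zero_sub, pow_zero, Finset.sum_const, smul_eq_mul, mul_one] at hsum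
    simp only [hP0, Nat.zero_sub, e₁, e₂, Set.ncard_singleton, Set.ncard_empty, pow_zero,
      Finset.sum_const, smul_eq_mul, mul_one, mul_zero]
    omega
  · have hlt : ∀ w ∈ M.accPaths x k ∪ M.rejPaths x k, P - w.length ≠ 0 := by
      intro w hw
      have := length_le_of_mem_paths (hP x k) hw
      rw [hPdef, Nat.succ_mul]
      omega
    -- Each accepting path contributes a surplus of 2 over $2^{P-|w|}$, and in `s₂` each rejecting
    -- path a deficit of 2. With `hsum` the doubled count differs from $2^P$ by twice the gap.
    have s₁ : 2 * ∑ w ∈ hfa.toFinset, {z : List Bool | z.length = P - w.length ∧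
        (balanceVerdict z).elim True (· = true)}.ncard =
        ∑ w ∈ hfa.toFinset, 2 ^ (P - w.length) + 2 * hfa.toFinset.card := by
      rw [Finset.mul_sum, mul_comm 2 (Finset.card _), ← smul_eq_mul (Finset.card _),
        ← Finset.sum_const, ← Finset.sum_add_distrib]
      exact Finset.sum_congr rfl fun w hw => ncard_balance_true (hlt w (.inl ((ha w).1 hw)))
    have s₂ : 2 * ∑ w ∈ hfr.toFinset, {z : List Bool | z.length = P - w.length ∧
        (balanceVerdict z).elim False (· = true)}.ncard + 2 * hfr.toFinset.card =
        ∑ w ∈ hfr.toFinset, 2 ^ (P - w.length) := by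
      rw [Finset.mul_sum, mul_comm 2 (Finset.card _), ← smul_eq_mul (Finset.card _),
        ← Finset.sum_const, ← Finset.sum_add_distrib]
      exact Finset.sum_congr rfl fun w hw => ncard_balance_false (hlt w (.inr ((hr w).1 hw)))
    omega

theorem half_lt_probAcc_iff_of_uniform {Q : List Bool → Prop}
    (h : M.accPaths x k = {y | y.length = P ∧ Q y}) :
    1 / 2 < M.probAcc x k ↔ 2 ^ P < 2 * {y | y.length = P ∧ Q y}.ncard := by
  have hfin := List.finite_length_and P Q
  have hlen : ∀ w ∈ hfin.toFinset, w.length = P := fun w hw => (hfin.mem_toFinset.1 hw).1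
  rw [half_lt_probAcc_iff (h.trans hfin.coe_toFinset.symm) fun w hw => (hlen w hw).le,
    Finset.sum_congr rfl fun w hw => by rw [hlen w hw, Nat.sub_self, pow_zero],
    Finset.sum_const, smul_eq_mul, mul_one, ← Set.ncard_eq_toFinset_card _ hfin]

/-- Accepting and rejecting paths together are all $2^P$ strings, so the gap is positive exactly
when more than half of them accept. -/
theorem gap_pos_iff_of_uniform {Q : List Bool → Prop}
    (h : M.accPaths x k = {y | y.length = P ∧ Q y})
    (h' : M.rejPaths x k = {y | y.length = P ∧ ¬ Q y}) :
    (M.numAcc x k : ℤ) - (M.numRej x k : ℤ) > 0 ↔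
      2 ^ P < 2 * {y | y.length = P ∧ Q y}.ncard := by
  have hu := Set.ncard_union_eq (s := M.accPaths x k) (t := M.rejPaths x k)
    disjoint_accPaths_rejPaths (h ▸ List.finite_length_and P Q)
    (h' ▸ List.finite_length_and P fun y => ¬ Q y)
  have : M.accPaths x k ∪ M.rejPaths x k = {y | y.length = P} := by
    rw [h, h']
    ext y
    by_cases hQ : Q y <;> simp [hQ]
  rw [this, List.ncard_length_eq_bool] at hu
  rw [← h, numAcc, numRej]
  omega

end NTM

/-! ### The equivalence -/

theorem mainTheorem2 {A : Type} [Finite A] (L : ParamLanguage A) :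
    List.TFAE
      [InWPPFPT L,
       ∃ M : NTM A, M.KRestricted ∧ ∀ (x : List A) (k : ℕ),
          (x, k) ∈ L ↔ (M.numAcc x k : ℤ) - (M.numRej x k : ℤ) > 0,
       ∃ h : List A → ℕ → ℤ, InGapFPT h ∧ ∀ (x : List A) (k : ℕ), (x, k) ∈ L ↔ h x k > 0,
       ∃ (B : ParamLanguage (A ⊕ Bool)) (f : ℕ → ℕ), InFPT B ∧ Computable f ∧
          ∀ (x : List A) (k : ℕ), (x, k) ∈ L ↔
            2 * {y : List Bool | y.length = f k * Nat.log 2 x.length ∧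
              (pairString x y, k) ∈ B}.ncard > 2 ^ (f k * Nat.log 2 x.length)] := by
  tfae_have 1 → 4 := by
    rintro ⟨M, hM, hL⟩
    obtain ⟨B, f, hB, hf, h⟩ := NTM.exists_fpt_majority_of_probAcc hM
    refine ⟨B, f, hB, hf, fun x k => Iff.trans ⟨(hL x k).1, fun hp => ?_⟩ (h x k)⟩
    by_contra hx
    exact absurd hp (not_lt.2 ((hL x k).2 hx))
  tfae_have 2 → 4 := by
    rintro ⟨M, hM, hL⟩
    obtain ⟨B, f, hB, hf, h⟩ := NTM.exists_fpt_majority_of_gap hM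
    exact ⟨B, f, hB, hf, fun x k => (hL x k).trans (h x k)⟩
  tfae_have 4 → 1 := by
    rintro ⟨B, f, hB, hf, hL⟩
    obtain ⟨M, hM, h⟩ := NTM.exists_guess_machine hB hf
    have key := fun x k => (hL x k).trans (NTM.half_lt_probAcc_iff_of_uniform (h x k).1).symm
    exact ⟨M, hM, fun x k => ⟨(key x k).1, fun hx => not_lt.1 fun hp => hx ((key x k).2 hp)⟩⟩
  tfae_have 4 → 2 := by
    rintro ⟨B, f, hB, hf, hL⟩
    obtain ⟨M, hM, h⟩ := NTM.exists_guess_machine hB hf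
    exact ⟨M, hM, fun x k =>
      (hL x k).trans (NTM.gap_pos_iff_of_uniform (h x k).1 (h x k).2).symm⟩
  tfae_have 2 → 3 := fun ⟨M, hM, hL⟩ => ⟨_, ⟨M, hM, fun _ _ => rfl⟩, hL⟩
  tfae_have 3 → 2 := by
    rintro ⟨h, ⟨M, hM, hh⟩, hL⟩
    exact ⟨M, hM, fun x k => by rw [hL, hh]⟩
  tfae_finish
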